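/- Let $p\ge 2$ be an integer. There are positive constants $c_4,c_5$ depending only on $p$ such that the following holds. Let $\mathfrak H,\mathfrak H_*$ be complex separable Hilbert spaces and $X(t)=\sum_{j=0}^p t^jX_j$, $t\in\mathbb R$, a pencil of linear operators from $\mathfrak H$ to $\mathfrak H_*$, where $X_0$ is densely defined and closed, $X_p$ is bounded and defined on all of $\mathfrak H$, $\operatorname{Dom}X(t)=\operatorname{Dom}X_0\subset\operatorname{Dom}X_j$ for all $t$ and $j=0,\dots,p$, and $\|X_ju\|\le C_0\|X_0u\|$ for $u\in\operatorname{Dom}X_0$, $j=0,\dots,p-1$, with a constant $C_0\ge 1$. Put $A(t)=X(t)^*X(t)$, $A_0=X_0^*X_0$, $\mathfrak N=\operatorname{Ker}X_0$, $\mathfrak N_*=\operatorname{Ker}X_0^*$, and let $P$ be the orthogonal projection of $\mathfrak H$ onto $\mathfrak N$. Assume that $0$ is an isolated point of the spectrum $\sigma(A_0)$, that $\dim\mathfrak N<\infty$ and that $\dim\mathfrak N\le\dim\mathfrak N_*\le\infty$. Let $d^0=\operatorname{dist}(0,\sigma(A_0)\setminus\{0\})$ (with $d^0=\infty$ if $\sigma(A_0)=\{0\}$),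 let $0<\delta\le\min\{d^0/36,1/4\}$, and let $0<t_0\le\delta^{1/2}C_1^{-1}$ with $C_1=\max\{(p-1)C_0,\|X_p\|\}$. For $\omega\in\mathfrak N$ let $\psi(\omega)\in\mathcal D:=\operatorname{Dom}X_0\cap\mathfrak N^\perp$ be the unique element with $(X_0\psi(\omega),X_0\zeta)=-(X_p\omega,X_0\zeta)$ for all $\zeta\in\mathcal D$. Define $Z:\mathfrak H\to\mathfrak H$ by $Z\omega=\psi(\omega)$ for $\omega\in\mathfrak N$ and $Zv=0$ for $v\in\mathfrak N^\perp$; define $R:\mathfrak N\to\mathfrak N_*$ by $R\omega=X_0\psi(\omega)+X_p\omega$; put $S=R^*R:\mathfrak N\to\mathfrak N$ and $$G=(RP)^*X_1Z+(X_1Z)^*RP,\qquad J(t,\tau)=\bigl(e^{-i\tau A(t)}-e^{-i\tau t^{2p}SP}\bigr)P .$$ Suppose that $G=0$. Then for all $\tau\in\mathbb R$, $\varepsilon>0$ and $|t|\le t_0$, $$\bigl\|J(t,\tau\varepsilon^{-2p})\bigr\|\,\frac{\varepsilon^{2p+2}}{(t^2+\varepsilon^2)^{p+1}}\le\bigl(2C_4\,t_0^{p-2}+C_5|\tau|\bigr)\varepsilon^2,$$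 where $C_4=c_4C_T^{\,p}$, $C_5=c_5C_T^{\,2p+2}$ and $C_T=pC_0^2+\|X_p\|^2\delta^{-1}$. -/

import Mathlib

open scoped InnerProductSpace

universe u v

noncomputable section

/-! ### Unbounded operators in complex Hilbert spaces -/

section Unbounded

variable {H : Type u} {K : Type v}
  [NormedAddCommGroup H] [InnerProductSpace ℂ H]
  [NormedAddCommGroup K] [InnerProductSpace ℂ K]

/-- The kernel of an unbounded operator, as a subspace of the whole space. -/
def opKer (T : H →ₗ.[ℂ] K) : Submodule ℂ H :=
  (LinearMap.ker T.toFun).map T.domain.subtype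

/-- The natural domain `{x ∈ Dom T : T x ∈ Dom S}` of the product `S T`. -/
def opCompDomain (S : K →ₗ.[ℂ] H) (T : H →ₗ.[ℂ] K) : Submodule ℂ H :=
  (S.domain.comap T.toFun).map T.domain.subtype

theorem opComp_aux (S : K →ₗ.[ℂ] H) (T : H →ₗ.[ℂ] K)
    (x : (T.domRestrict (opCompDomain S T)).domain) :
    (T.domRestrict (opCompDomain S T)) x ∈ S.domain := by
  obtain ⟨x, hx⟩ := x
  have hx' : x ∈ opCompDomain S T ⊓ T.domain := hx
  obtain ⟨y, hy, hyx⟩ := hx'.1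
  have hyx' : (y : H) = x := hyx
  have : (T.domRestrict (opCompDomain S T)) ⟨x, hx⟩ = T y :=
    LinearPMap.domRestrict_apply hyx'.symm
  rw [this]
  exact hy

/-- The product `S T` of unbounded operators, on its natural domain. -/
def opComp (S : K →ₗ.[ℂ] H) (T : H →ₗ.[ℂ] K) : H →ₗ.[ℂ] H :=
  S.comp (T.domRestrict (opCompDomain S T)) (opComp_aux S T)

/-- The spectrum of an unbounded operator: the set of those `z` for which `A - z` does not have a
bounded everywhere defined two-sided inverse `B`. -/
def opSpectrum (A : H →ₗ.[ℂ] H) : Set ℂ :=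
  {z | ¬ ∃ B : H →L[ℂ] H,
      (∀ x : A.domain, B (A x - z • (x : H)) = x) ∧
      (∀ y : H, ∃ h : B y ∈ A.domain, A ⟨B y, h⟩ - z • B y = y)}

variable [CompleteSpace H]

/-- `U` is the strongly continuous one-parameter unitary group with generator `-iA`
(so that `U τ = exp (-iτA)`). In particular the domain of `A` is exactly the set of vectors `x`
for which `τ ↦ U τ x` is differentiable at `0`. -/
structure IsUnitaryGroupOf (A : H →ₗ.[ℂ] H) (U : ℝ → H →L[ℂ] H) : Prop where
  map_zero : U 0 = 1
  map_add : ∀ s τ : ℝ, U (s + τ) = U s * U τ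
  mem_unitary : ∀ τ : ℝ, U τ ∈ unitary (H →L[ℂ] H)
  continuous : ∀ x : H, Continuous fun τ : ℝ => U τ x
  generator : ∀ x y : H, HasDerivAt (fun τ : ℝ => U τ x) y 0 ↔
    ∃ h : x ∈ A.domain, y = -(Complex.I • A ⟨x, h⟩)

open Classical in
/-- The operator exponential `exp (-iτA)` of a selfadjoint operator `A`. The group with generator
`-iA` exists, and is unique, exactly when `A` is selfadjoint (Stone's theorem);
for other `A` the value is `0`. -/
def unitaryExp (A : H →ₗ.[ℂ] H) (τ : ℝ) : H →L[ℂ] H :=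
  if h : ∃ U : ℝ → H →L[ℂ] H, IsUnitaryGroupOf A U then h.choose τ else 0

end Unbounded

/-! ### The abstract setting -/

section Pencil

variable {H : Type u} {K : Type v}
  [NormedAddCommGroup H] [InnerProductSpace ℂ H] [CompleteSpace H]
  [NormedAddCommGroup K] [InnerProductSpace ℂ K] [CompleteSpace K]

/-- The pencil `X(t) = ∑_{j=0}^p t^j X_j`, on its natural domain. -/
def pencil (p : ℕ) (X : ℕ → H →ₗ.[ℂ] K) (t : ℝ) : H →ₗ.[ℂ] K :=
  ∑ j ∈ Finset.range (p + 1), ((t : ℂ) ^ j) • X j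

/-- The data `X_0, …, X_p` and `C_0` of a polynomial operator pencil of degree `p ≥ 2` from `H`
to `K`, with the standing assumptions on them. Only the `X j` with `j ≤ p` matter; `Xp` is `X p`
as a bounded operator. -/
structure OperatorPencil (p : ℕ) (H : Type u) (K : Type v)
    [NormedAddCommGroup H] [InnerProductSpace ℂ H] [CompleteSpace H]
    [NormedAddCommGroup K] [InnerProductSpace ℂ K] [CompleteSpace K] where
  two_le : 2 ≤ p
  X : ℕ → H →ₗ.[ℂ] K
  Xp : H →L[ℂ] K
  C₀ : ℝ
  /-- `X_0` is densely defined and closed. -/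
  dense_domain : Dense ((X 0).domain : Set H)
  isClosed : (X 0).IsClosed
  /-- `X_p` is bounded and defined on the whole space. -/
  X_p_eq : X p = (Xp : H →ₗ[ℂ] K).toPMap ⊤
  /-- `Dom X(t) = Dom X_0 ⊂ Dom X_j`. -/
  domain_pencil : ∀ t : ℝ, (pencil p X t).domain = (X 0).domain
  domain_le : ∀ j ≤ p, (X 0).domain ≤ (X j).domain
  /-- `‖X_j u‖ ≤ C_0 ‖X_0 u‖` on `Dom X_0` for `j ≤ p - 1`, with `C_0 ≥ 1`. -/
  one_le_C₀ : 1 ≤ C₀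
  norm_le : ∀ j (hj : j < p) (x : (X 0).domain),
    ‖X j ⟨x, domain_le j hj.le x.2⟩‖ ≤ C₀ * ‖X 0 x‖
  /-- `0` is an isolated point of the spectrum of `A_0 = X_0^* X_0`. -/
  zero_mem_spectrum : (0 : ℂ) ∈ opSpectrum (opComp (X 0).adjoint (X 0))
  zero_isolated : (0 : ℂ) ∉ closure (opSpectrum (opComp (X 0).adjoint (X 0)) \ {0})
  /-- `n = dim Ker X_0 < ∞` and `n ≤ n_* = dim Ker X_0^*`. -/
  finite_ker : FiniteDimensional ℂ (opKer (X 0))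
  finrank_le : (Module.finrank ℂ (opKer (X 0)) : Cardinal) ≤
    Module.rank ℂ (opKer (X 0).adjoint)

namespace OperatorPencil

variable {p : ℕ} (𝒳 : OperatorPencil p H K)

/-- `A(t) = X(t)^* X(t)`. -/
def A (t : ℝ) : H →ₗ.[ℂ] H :=
  opComp (pencil p 𝒳.X t).adjoint (pencil p 𝒳.X t)

/-- `A_0 = X_0^* X_0`. -/
def A₀ : H →ₗ.[ℂ] H := opComp (𝒳.X 0).adjoint (𝒳.X 0)

/-- `𝔑 = Ker X_0`. -/
def N : Submodule ℂ H := opKer (𝒳.X 0)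

instance instFiniteDimensionalN : FiniteDimensional ℂ 𝒳.N := 𝒳.finite_ker

instance instHasOrthogonalProjectionN : 𝒳.N.HasOrthogonalProjection :=
  haveI : CompleteSpace 𝒳.N := FiniteDimensional.complete ℂ 𝒳.N
  inferInstance

/-- The orthogonal projection of `H` onto `𝔑`, with values in `𝔑`. -/
def toN : H →L[ℂ] 𝒳.N := 𝒳.N.orthogonalProjectionOnto

/-- The orthogonal projection `P` of `H` onto `𝔑`, as an operator in `H`. -/
def P : H →L[ℂ] H := 𝒳.N.subtypeL ∘L 𝒳.toN

/-- The distance `d⁰` from `0` to the rest of the spectrum of `A_0`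
(it is `∞` if there is no other spectrum). -/
def d₀ : ENNReal := Metric.infEDist (0 : ℂ) (opSpectrum 𝒳.A₀ \ {0})

/-- `ψ` is the linear map that takes `ω ∈ 𝔑` to the solution `ψ(ω) ∈ 𝒟 = Dom X_0 ∩ 𝔑^⊥` of
`X_0^* (X_0 ψ + X_p ω) = 0`, understood in the weak sense. -/
def IsCorrector (ψ : 𝒳.N →ₗ[ℂ] (𝒳.X 0).domain) : Prop :=
  ∀ ω : 𝒳.N, (ψ ω : H) ∈ 𝒳.Nᗮ ∧
    ∀ ζ : (𝒳.X 0).domain, (ζ : H) ∈ 𝒳.Nᗮ →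
      ⟪𝒳.X 0 (ψ ω), 𝒳.X 0 ζ⟫_ℂ = ⟪-(𝒳.Xp ω), 𝒳.X 0 ζ⟫_ℂ

open Classical in
/-- The map `ω ↦ ψ(ω)` (it exists, since the range of `X_0` is closed, and it is unique). -/
def corrector : 𝒳.N →ₗ[ℂ] (𝒳.X 0).domain :=
  if h : ∃ ψ, 𝒳.IsCorrector ψ then h.choose else 0

/-- The operator `Z`: it is `ω ↦ ψ(ω)` on `𝔑` and zero on `𝔑^⊥`. -/
def Z : H →L[ℂ] H :=
  LinearMap.toContinuousLinearMap ((𝒳.X 0).domain.subtype ∘ₗ 𝒳.corrector) ∘L 𝒳.toN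

theorem Z_mem_domain (x : H) : 𝒳.Z x ∈ (𝒳.X 0).domain :=
  (𝒳.corrector (𝒳.toN x)).2

/-- The operator `X_1 Z`. -/
def X₁Z : H →L[ℂ] K :=
  LinearMap.toContinuousLinearMap
    ((𝒳.X 1).toFun ∘ₗ
      Submodule.inclusion (𝒳.domain_le 1 (one_le_two.trans 𝒳.two_le)) ∘ₗ 𝒳.corrector) ∘L 𝒳.toN

theorem X₁Z_apply (x : H) :
    𝒳.X₁Z x = 𝒳.X 1 ⟨𝒳.Z x,
      𝒳.domain_le 1 (one_le_two.trans 𝒳.two_le) (𝒳.Z_mem_domain x)⟩ := rfl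

/-- The operator `R ω = X_0 ψ(ω) + X_p ω` on `𝔑`. Its values lie in `𝔑_* = Ker X_0^*`; it is
regarded here as an operator into `K ⊇ 𝔑_*`, which does not change `R^* R`. -/
def R : 𝒳.N →L[ℂ] K :=
  LinearMap.toContinuousLinearMap ((𝒳.X 0).toFun ∘ₗ 𝒳.corrector) + 𝒳.Xp ∘L 𝒳.N.subtypeL

/-- The spectral germ `S = R^* R : 𝔑 → 𝔑`. -/
def S : 𝒳.N →L[ℂ] 𝒳.N := ContinuousLinearMap.adjoint 𝒳.R ∘L 𝒳.R

/-- `S P` as an operator in `H`. -/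
def SP : H →L[ℂ] H := 𝒳.N.subtypeL ∘L 𝒳.S ∘L 𝒳.toN

/-- `R P` as an operator from `H` to `K`. -/
def RP : H →L[ℂ] K := 𝒳.R ∘L 𝒳.toN

/-- `G = (RP)^* X_1 Z + (X_1 Z)^* RP`. -/
def G : H →L[ℂ] H :=
  ContinuousLinearMap.adjoint 𝒳.RP ∘L 𝒳.X₁Z + ContinuousLinearMap.adjoint 𝒳.X₁Z ∘L 𝒳.RP

/-- `J(t,τ) = (exp (-iτA(t)) - exp (-iτ t^{2p} SP)) P`. -/
def J (t τ : ℝ) : H →L[ℂ] H :=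
  (unitaryExp (𝒳.A t) τ -
    NormedSpace.exp ((-(Complex.I * (τ : ℂ) * (t : ℂ) ^ (2 * p))) • 𝒳.SP)) ∘L 𝒳.P

/-- `C_1 = max {(p-1) C_0, ‖X_p‖}`. -/
def C₁ : ℝ := max (((p : ℝ) - 1) * 𝒳.C₀) ‖𝒳.Xp‖

/-- `C_T = p C_0² + ‖X_p‖² δ⁻¹`. -/
def C_T (δ : ℝ) : ℝ := (p : ℝ) * 𝒳.C₀ ^ 2 + ‖𝒳.Xp‖ ^ 2 * δ⁻¹

end OperatorPencil

end Pencil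

end

/-! ### The resolvent of `T^* T` -/

section FormResolvent

variable {H : Type u} {K : Type v}
  [NormedAddCommGroup H] [InnerProductSpace ℂ H]
  [NormedAddCommGroup K] [InnerProductSpace ℂ K]

/-! On `𝔑` the pencil reduces to `t^p X_p`, since `norm_le` makes `X_j` vanish there for `j < p`; on
`𝔑^⊥` the spectral gap keeps `X(t)` bounded below for `|t| ≤ t₀`. So `A(t)` can be reduced to `𝔑` by
a Schur complement, without spectral projections. Each `ω ∈ 𝔑` has a correction `Yω ∈ Dom X_0 ∩ 𝔑^⊥`
of size `O(|t|^p)` for which `X(t)(ω + Yω)` is orthogonal to `X(t)(Dom X_0 ∩ 𝔑^⊥)`. Then `A(t)(ω +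
Yω) = Qω` holds exactly, with `Q` acting in `𝔑` (`IsCorrection.A_apply`).

Replacing `Y` by the trial correction `t^p Z` changes the form of `Q` only by the square of the
error (`IsCorrection.inner_schur_eq`), and that error is `O(|t|^{p+1})`
(`IsCorrection.norm_map_sub_corrector_le`). Since `X(t)(ω + t^p Zω) = t^p (Rω + t X_1 Zω + O(t²))`,
the coefficient of `t^{2p}` is `S` and that of `t^{2p+1}` is the form of `G`, which vanishes. Hence
`Q = t^{2p} S + O(|t|^{2p+2})`.

Consequently `(1 + Y) P exp(-iτ t^{2p} SP) x` solves `w' = -iA(t)w` up to a residual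
`O(|t|^{2p+2})`, and Duhamel's principle (`IsUnitaryGroupOf.norm_sub_apply_le`) gives `‖J(t,τ)‖ ≤
a|t|^p + b|t|^{2p+2}|τ|` (`Small.norm_J_le`). The smoothing factor turns this into a bound of order
`ε²`.

Two facts about `T^* T` are needed: the unitary group exists, and a gap in the spectrum bounds
`‖Tu‖` from below on `(Ker T)^⊥`. Both follow from continuous functional calculus for the bounded
operator `B = (T^* T + 1)⁻¹`. -/

theorem mem_opComp_domain_iff {S : K →ₗ.[ℂ] H} {T : H →ₗ.[ℂ] K} {x : H} :
    x ∈ (opComp S T).domain ↔ ∃ h : x ∈ T.domain, T ⟨x, h⟩ ∈ S.domain := by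
  constructor
  · rintro ⟨⟨y, hy, rfl⟩, -⟩
    exact ⟨y.2, hy⟩
  · rintro ⟨h, hS⟩
    exact ⟨⟨⟨x, h⟩, hS, rfl⟩, h⟩

theorem opComp_apply {S : K →ₗ.[ℂ] H} {T : H →ₗ.[ℂ] K} {x : H}
    (hx : x ∈ (opComp S T).domain) (h : x ∈ T.domain) (hS : T ⟨x, h⟩ ∈ S.domain) :
    opComp S T ⟨x, hx⟩ = S ⟨T ⟨x, h⟩, hS⟩ := rfl

variable [CompleteSpace H]

theorem mem_opComp_adjoint_self_iff {T : H →ₗ.[ℂ] K} (hT : Dense (T.domain : Set H)) {x y : H} :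
    (∃ h : x ∈ (opComp T.adjoint T).domain, opComp T.adjoint T ⟨x, h⟩ = y) ↔
      ∃ h : x ∈ T.domain, ∀ v : T.domain, ⟪T ⟨x, h⟩, T v⟫_ℂ = ⟪y, (v : H)⟫_ℂ := by
  constructor
  · rintro ⟨h, rfl⟩
    obtain ⟨hx, hS⟩ := mem_opComp_domain_iff.1 h
    refine ⟨hx, fun v => ?_⟩
    rw [opComp_apply h hx hS]
    exact (T.adjoint_isFormalAdjoint hT ⟨_, hS⟩ v).symm
  · rintro ⟨hx, hv⟩
    have hS : T ⟨x, hx⟩ ∈ T.adjoint.domain :=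
      T.mem_adjoint_domain_of_exists _ ⟨y, fun v => (hv v).symm⟩
    refine ⟨mem_opComp_domain_iff.2 ⟨hx, hS⟩, ?_⟩
    rw [opComp_apply _ hx hS]
    exact LinearPMap.adjoint_apply_eq hT _ fun v => (hv v).symm

/-- `B` solves `⟪T B f, T v⟫ + ⟪B f, v⟫ = ⟪f, v⟫` for `v ∈ Dom T`, that is,
`B = (T^* T + 1)⁻¹`. -/
structure IsFormResolvent (T : H →ₗ.[ℂ] K) (B : H →L[ℂ] H) : Prop where
  mem : ∀ f, B f ∈ T.domain
  inner_eq : ∀ f (v : T.domain), ⟪T ⟨B f, mem f⟩, T v⟫_ℂ + ⟪B f, (v : H)⟫_ℂ = ⟪f, (v : H)⟫_ℂ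

/-- Von Neumann's argument: `(B f, T B f)` is the orthogonal projection of `(f, 0)` onto the closed
graph of `T`, and orthogonality of the difference to the graph is the weak equation. The `L²`
product is used because the plain product carries the sup norm. -/
theorem exists_isFormResolvent [CompleteSpace K] {T : H →ₗ.[ℂ] K} (hT : T.IsClosed) :
    ∃ B, IsFormResolvent T B := by
  let e := WithLp.prodContinuousLinearEquiv 2 ℂ H K
  let Γ : Submodule ℂ (WithLp 2 (H × K)) := T.graph.comap (e : WithLp 2 (H × K) →ₗ[ℂ] H × K)
  have hΓ : IsClosed (Γ : Set (WithLp 2 (H × K))) := hT.preimage e.continuous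
  have : CompleteSpace Γ := hΓ.completeSpace_coe
  let inl : H →L[ℂ] WithLp 2 (H × K) :=
    (e.symm : H × K →L[ℂ] WithLp 2 (H × K)) ∘L ContinuousLinearMap.inl ℂ H K
  let Q : H →L[ℂ] WithLp 2 (H × K) := Γ.starProjection ∘L inl
  have hQ : ∀ f, e (Q f) ∈ T.graph := fun f => Γ.starProjection_apply_mem (inl f)
  let B : H →L[ℂ] H :=
    ContinuousLinearMap.fst ℂ H K ∘L (e : WithLp 2 (H × K) →L[ℂ] H × K) ∘L Q
  have hB : ∀ f, ∃ h : B f ∈ T.domain, T ⟨B f, h⟩ = (e (Q f)).2 := by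
    intro f
    obtain ⟨y, hy, hy'⟩ := T.mem_graph_iff.1 (hQ f)
    have : B f = y := hy.symm
    refine ⟨this ▸ y.2, ?_⟩
    rw [← hy']
    congr 1
    exact Subtype.ext this
  refine ⟨B, fun f => (hB f).1, fun f v => ?_⟩
  have hv : e.symm ((v : H), T v) ∈ Γ := by
    change e (e.symm ((v : H), T v)) ∈ T.graph
    rw [e.apply_symm_apply]
    exact T.mem_graph v
  have h0 := Submodule.starProjection_inner_eq_zero (K := Γ) (inl f) _ hv
  rw [WithLp.prod_inner_apply] at h0
  rw [(hB f).2]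
  change ⟪f - B f, (v : H)⟫_ℂ + ⟪0 - (e (Q f)).2, T v⟫_ℂ = 0 at h0
  rw [inner_sub_left, zero_sub, inner_neg_left] at h0
  linear_combination -h0

namespace IsFormResolvent

variable {T : H →ₗ.[ℂ] K} {B : H →L[ℂ] H}

omit [CompleteSpace H] in
theorem inner_apply_self_re (hB : IsFormResolvent T B) (f : H) :
    ⟪B f, f⟫_ℂ = ((‖T ⟨B f, hB.mem f⟩‖ ^ 2 + ‖B f‖ ^ 2 : ℝ) : ℂ) := by
  have h : ⟪f, B f⟫_ℂ = ((‖T ⟨B f, hB.mem f⟩‖ ^ 2 + ‖B f‖ ^ 2 : ℝ) : ℂ) := by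
    have h := hB.inner_eq f ⟨B f, hB.mem f⟩
    rw [inner_self_eq_norm_sq_to_K, inner_self_eq_norm_sq_to_K] at h
    rw [← h]
    push_cast
    rfl
  rw [← inner_conj_symm, h, Complex.conj_ofReal]

theorem isSelfAdjoint (hB : IsFormResolvent T B) : IsSelfAdjoint B := by
  rw [ContinuousLinearMap.isSelfAdjoint_iff_isSymmetric]
  intro f g
  have h1 := hB.inner_eq f ⟨B g, hB.mem g⟩
  have h2 := congrArg (starRingEnd ℂ) (hB.inner_eq g ⟨B f, hB.mem f⟩)
  simp only [map_add, inner_conj_symm] at h2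
  change ⟪B f, g⟫_ℂ = ⟪f, B g⟫_ℂ
  rw [← h1, ← h2]

omit [CompleteSpace H] in
theorem nonneg (hB : IsFormResolvent T B) : 0 ≤ B := by
  rw [ContinuousLinearMap.nonneg_iff_isPositive, ContinuousLinearMap.isPositive_iff_complex]
  intro f
  rw [hB.inner_apply_self_re f, RCLike.re_eq_complex_re, Complex.ofReal_re]
  refine ⟨rfl, ?_⟩
  positivity

omit [CompleteSpace H] in
theorem norm_apply_le (hB : IsFormResolvent T B) (f : H) : ‖B f‖ ≤ ‖f‖ := by
  have h := congrArg Complex.re (hB.inner_apply_self_re f)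
  rw [Complex.ofReal_re] at h
  have h2 : (⟪B f, f⟫_ℂ).re ≤ ‖B f‖ * ‖f‖ := re_inner_le_norm (𝕜 := ℂ) _ _
  by_contra! hc
  nlinarith [norm_nonneg f, norm_nonneg (B f), sq_nonneg ‖T ⟨B f, hB.mem f⟩‖]

omit [CompleteSpace H] in
theorem norm_le_one (hB : IsFormResolvent T B) : ‖B‖ ≤ 1 :=
  B.opNorm_le_bound zero_le_one fun f => by simpa using hB.norm_apply_le f

omit [CompleteSpace H] in
theorem ker_eq_bot (hB : IsFormResolvent T B) (hT : Dense (T.domain : Set H)) :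
    LinearMap.ker (B : H →ₗ[ℂ] H) = ⊥ := by
  rw [LinearMap.ker_eq_bot']
  intro f hf
  have hf : B f = 0 := hf
  have hz : (⟨B f, hB.mem f⟩ : T.domain) = 0 := Subtype.ext hf
  refine hT.eq_zero_of_inner_left (𝕜 := ℂ) fun v hv => ?_
  rw [← hB.inner_eq f ⟨v, hv⟩, hz, hf]
  simp

theorem denseRange (hB : IsFormResolvent T B) (hT : Dense (T.domain : Set H)) :
    DenseRange B := by
  have h := B.orthogonal_range
  rw [hB.isSelfAdjoint.adjoint_eq, hB.ker_eq_bot hT] at h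
  have h' := (Submodule.topologicalClosure_eq_top_iff (K := LinearMap.range B.toLinearMap)).2 h
  rw [← Submodule.dense_iff_topologicalClosure_eq_top] at h'
  exact h'

/-- `T^* T` is the operator `B⁻¹ - 1`. -/
theorem mem_opComp_iff (hB : IsFormResolvent T B) (hT : Dense (T.domain : Set H)) {x y : H} :
    (∃ h : x ∈ (opComp T.adjoint T).domain, opComp T.adjoint T ⟨x, h⟩ = y) ↔ x = B (x + y) := by
  rw [mem_opComp_adjoint_self_iff hT]
  constructor
  · rintro ⟨hx, hv⟩
    have h1 : ∀ v : T.domain, ⟪T (⟨x, hx⟩ - ⟨B (x + y), hB.mem _⟩), T v⟫_ℂ +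
        ⟪x - B (x + y), (v : H)⟫_ℂ = 0 := by
      intro v
      have h2 := hB.inner_eq (x + y) v
      have h3 := hv v
      rw [T.map_sub, inner_sub_left, inner_sub_left]
      rw [inner_add_left] at h2
      linear_combination h3 - h2
    -- Uniqueness: the homogeneous weak equation is tested with its own solution.
    have h4 := h1 (⟨x, hx⟩ - ⟨B (x + y), hB.mem _⟩)
    have h6 : ‖x - B (x + y)‖ ^ 2 ≤ 0 := by
      have h7 := congrArg RCLike.re h4
      rw [map_add, inner_self_eq_norm_sq, map_zero] at h7
      have h8 : RCLike.re ⟪x - B (x + y), x - B (x + y)⟫_ℂ = ‖x - B (x + y)‖ ^ 2 :=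
        inner_self_eq_norm_sq _
      have h9 := sq_nonneg ‖T (⟨x, hx⟩ - ⟨B (x + y), hB.mem _⟩)‖
      change _ + RCLike.re ⟪x - B (x + y), x - B (x + y)⟫_ℂ = 0 at h7
      linarith
    have h6 : ‖x - B (x + y)‖ = 0 := pow_eq_zero_iff two_ne_zero |>.1 (le_antisymm h6 (sq_nonneg _))
    exact sub_eq_zero.1 (norm_eq_zero.1 h6)
  · intro h
    have hx : x ∈ T.domain := h ▸ hB.mem _
    refine ⟨hx, fun v => ?_⟩
    have h2 := hB.inner_eq (x + y) v
    have h3 : (⟨x, hx⟩ : T.domain) = ⟨B (x + y), hB.mem _⟩ := Subtype.ext h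
    have h4 : ⟪B (x + y), (v : H)⟫_ℂ = ⟪x, (v : H)⟫_ℂ := by rw [← h]
    rw [h3]
    rw [h4, inner_add_left] at h2
    linear_combination h2

end IsFormResolvent

end FormResolvent

/-! ### The unitary group generated by `-i (B⁻¹ - 1)` -/

section UnitaryGroup

/-- The function `r exp (-iτ(1/r - 1))`, with value `0` at `r = 0`. -/
noncomputable def mulExpInv (τ r : ℝ) : ℂ :=
  r * Complex.exp (Complex.I * ((-(τ * (r⁻¹ - 1)) : ℝ) : ℂ))

theorem norm_mulExpInv (τ r : ℝ) : ‖mulExpInv τ r‖ = |r| := by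
  rw [mulExpInv, norm_mul, mul_comm Complex.I, Complex.norm_exp_ofReal_mul_I, mul_one,
    Complex.norm_real, Real.norm_eq_abs]

theorem continuous_mulExpInv (τ : ℝ) : Continuous (mulExpInv τ) := by
  rw [continuous_iff_continuousAt]
  intro r
  rcases eq_or_ne r 0 with rfl | hr
  · have h0 : mulExpInv τ 0 = 0 := by simp [mulExpInv]
    rw [ContinuousAt, h0, tendsto_zero_iff_norm_tendsto_zero]
    simp only [norm_mulExpInv]
    simpa using (continuous_abs (G := ℝ)).tendsto 0
  · unfold mulExpInv
    have : ContinuousAt (fun r : ℝ => r⁻¹) r := continuousAt_inv₀ hr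
    fun_prop

theorem mulExpInv_zero (r : ℝ) : mulExpInv 0 r = r := by simp [mulExpInv]

theorem mulExpInv_mul (s τ r : ℝ) : mulExpInv s r * mulExpInv τ r = r * mulExpInv (s + τ) r := by
  simp only [mulExpInv]
  rw [mul_mul_mul_comm, ← Complex.exp_add, mul_assoc]
  congr 3
  push_cast
  ring

theorem star_mulExpInv (τ r : ℝ) : star (mulExpInv τ r) = mulExpInv (-τ) r := by
  simp only [mulExpInv, star_mul', Complex.star_def, Complex.conj_ofReal, ← Complex.exp_conj,
    map_mul, Complex.conj_I]
  congr 2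
  push_cast
  ring

/-- The frequency `1/r - 1` is unbounded, but the factor `r` reduces it to `1 - r ∈ [0, 1]`. -/
theorem norm_mulExpInv_sub_le {r : ℝ} (h0 : 0 ≤ r) (h1 : r ≤ 1) (s τ : ℝ) :
    ‖mulExpInv τ r - mulExpInv s r‖ ≤ |τ - s| := by
  rcases h0.eq_or_lt with rfl | hr
  · simp [mulExpInv]
  have h : mulExpInv τ r - mulExpInv s r = mulExpInv s r *
      (Complex.exp (Complex.I * ((-((τ - s) * (r⁻¹ - 1)) : ℝ) : ℂ)) - 1) := by
    simp only [mulExpInv]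
    have h2 : Complex.I * ((-(τ * (r⁻¹ - 1)) : ℝ) : ℂ) = Complex.I * ((-(s * (r⁻¹ - 1)) : ℝ) : ℂ) +
        Complex.I * ((-((τ - s) * (r⁻¹ - 1)) : ℝ) : ℂ) := by
      push_cast
      ring
    rw [h2, Complex.exp_add]
    ring
  rw [h, norm_mul, norm_mulExpInv, abs_of_pos hr]
  calc r * _ ≤ r * ‖-((τ - s) * (r⁻¹ - 1))‖ := by
        gcongr
        exact Real.norm_exp_I_mul_ofReal_sub_one_le
    _ = |τ - s| * (1 - r) := by
        rw [norm_neg, norm_mul, Real.norm_eq_abs, Real.norm_eq_abs,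
          abs_of_nonneg (sub_nonneg.2 ((one_le_inv₀ hr).2 h1))]
        field_simp
    _ ≤ |τ - s| := mul_le_of_le_one_right (abs_nonneg _) (by linarith)

theorem norm_exp_I_mul_sub_sub_le (x : ℝ) :
    ‖Complex.exp (Complex.I * x) - 1 - Complex.I * x‖ ≤ 2 * x ^ 2 := by
  have hx : ‖Complex.I * x‖ = |x| := by simp
  rcases le_total |x| 1 with h | h
  · have := Complex.norm_exp_sub_one_sub_id_le (hx.trans_le h)
    rw [hx, sq_abs] at this
    nlinarith [sq_nonneg x]
  · have h2 := Real.norm_exp_I_mul_ofReal_sub_one_le (x := x)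
    have h3 := norm_sub_le (Complex.exp (Complex.I * x) - 1) (Complex.I * x)
    rw [hx] at h3
    rw [Real.norm_eq_abs] at h2
    nlinarith [sq_abs x]

/-- Two factors `r` absorb the square of the frequency `1/r - 1`, so the Taylor remainder is uniform
in `r`. -/
theorem norm_mulExpInv_mul_sub_le {r : ℝ} (h0 : 0 ≤ r) (h1 : r ≤ 1) (τ : ℝ) :
    ‖mulExpInv τ r * r - r * r + Complex.I * τ * (r - r * r)‖ ≤ 2 * τ ^ 2 := by
  rcases h0.eq_or_lt with rfl | hr
  · simp [mulExpInv]
    positivity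
  have hr' : (r : ℂ) ≠ 0 := by exact_mod_cast hr.ne'
  have h : mulExpInv τ r * r - r * r + Complex.I * τ * (r - r * r) = ((r ^ 2 : ℝ) : ℂ) *
      (Complex.exp (Complex.I * ((-(τ * (r⁻¹ - 1)) : ℝ) : ℂ)) - 1 -
        Complex.I * ((-(τ * (r⁻¹ - 1)) : ℝ) : ℂ)) := by
    simp only [mulExpInv]
    generalize Complex.exp (Complex.I * ((-(τ * (r⁻¹ - 1)) : ℝ) : ℂ)) = e
    push_cast
    field_simp
    ring
  rw [h, norm_mul, Complex.norm_real, Real.norm_of_nonneg (by positivity)]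
  calc r ^ 2 * _ ≤ r ^ 2 * (2 * (-(τ * (r⁻¹ - 1))) ^ 2) := by
        gcongr
        exact norm_exp_I_mul_sub_sub_le _
    _ = 2 * τ ^ 2 * (1 - r) ^ 2 := by field_simp
    _ ≤ 2 * τ ^ 2 := mul_le_of_le_one_right (by positivity) (by nlinarith)

variable {H : Type u} [NormedAddCommGroup H] [InnerProductSpace ℂ H] [CompleteSpace H]
  {B : H →L[ℂ] H}

open scoped ComplexOrder in
theorem eq_ofReal_of_mem_spectrum (h0 : 0 ≤ B) (h1 : ‖B‖ ≤ 1) {z : ℂ} (hz : z ∈ spectrum ℂ B) :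
    (z.re : ℂ) = z ∧ 0 ≤ z.re ∧ z.re ≤ 1 := by
  have h := spectrum_nonneg_of_nonneg h0 hz
  rw [Complex.nonneg_iff] at h
  refine ⟨Complex.ext rfl h.2, h.1, ?_⟩
  refine (Complex.re_le_norm z).trans ((spectrum.norm_le_norm_mul_of_mem hz).trans ?_)
  exact mul_le_one₀ h1 (norm_nonneg _) ContinuousLinearMap.norm_id_le

/-- The operator `exp (-iτ(B⁻¹ - 1)) B`. -/
noncomputable def mulExpInvOp (B : H →L[ℂ] H) (τ : ℝ) : H →L[ℂ] H :=
  cfc (fun z : ℂ => mulExpInv τ z.re) B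

theorem continuous_mulExpInv_re (τ : ℝ) : Continuous fun z : ℂ => mulExpInv τ z.re :=
  (continuous_mulExpInv τ).comp Complex.continuous_re

variable (h0 : 0 ≤ B) (h1 : ‖B‖ ≤ 1)

include h0 h1

theorem mulExpInvOp_zero : mulExpInvOp B 0 = B := by
  have hs : IsStarNormal B := (IsSelfAdjoint.of_nonneg h0).isStarNormal
  conv_rhs => rw [← cfc_id ℂ B]
  refine cfc_congr fun z hz => ?_
  simp only [mulExpInv_zero, (eq_ofReal_of_mem_spectrum h0 h1 hz).1, id]

theorem mulExpInvOp_mul (s τ : ℝ) :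
    mulExpInvOp B s * mulExpInvOp B τ = B * mulExpInvOp B (s + τ) := by
  have hs : IsStarNormal B := (IsSelfAdjoint.of_nonneg h0).isStarNormal
  have h : B * mulExpInvOp B (s + τ) = mulExpInvOp B 0 * mulExpInvOp B (s + τ) := by
    rw [mulExpInvOp_zero h0 h1]
  rw [h]
  simp only [mulExpInvOp]
  rw [← cfc_mul _ _ B (continuous_mulExpInv_re _).continuousOn
    (continuous_mulExpInv_re _).continuousOn, ← cfc_mul _ _ B
    (continuous_mulExpInv_re _).continuousOn (continuous_mulExpInv_re _).continuousOn]
  refine cfc_congr fun z hz => ?_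
  simp only [mulExpInv_mul, mulExpInv_zero]

omit h0 h1 in
theorem star_mulExpInvOp (τ : ℝ) : star (mulExpInvOp B τ) = mulExpInvOp B (-τ) := by
  simp only [mulExpInvOp, ← cfc_star, star_mulExpInv]

theorem mulExpInvOp_comm (τ : ℝ) (x : H) : mulExpInvOp B τ (B x) = B (mulExpInvOp B τ x) := by
  have h := mulExpInvOp_mul h0 h1 τ 0
  rw [mulExpInvOp_zero h0 h1, add_zero] at h
  exact DFunLike.congr_fun h x

/-- On the spectrum the function has modulus `r`. This identity makes `B x ↦ mulExpInvOp B τ x`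
isometric, so that it extends from the dense range of `B`. -/
theorem norm_mulExpInvOp_apply (τ : ℝ) (x : H) : ‖mulExpInvOp B τ x‖ = ‖B x‖ := by
  have h : star (mulExpInvOp B τ) * mulExpInvOp B τ = star B * B := by
    rw [star_mulExpInvOp, mulExpInvOp_mul h0 h1, neg_add_cancel, mulExpInvOp_zero h0 h1,
      (IsSelfAdjoint.of_nonneg h0).star_eq]
  have h2 : ∀ C : H →L[ℂ] H, ⟪(star C * C) x, x⟫_ℂ = ((‖C x‖ ^ 2 : ℝ) : ℂ) := by
    intro C
    rw [mul_apply_eq_comp, ContinuousLinearMap.star_eq_adjoint,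
      ContinuousLinearMap.adjoint_inner_left, inner_self_eq_norm_sq_to_K]
    norm_cast
  have h3 := h2 (mulExpInvOp B τ)
  rw [h, h2 B] at h3
  exact ((sq_eq_sq₀ (norm_nonneg _) (norm_nonneg _)).1 (by exact_mod_cast h3)).symm

theorem norm_mulExpInvOp_sub_le (s τ : ℝ) : ‖mulExpInvOp B τ - mulExpInvOp B s‖ ≤ |τ - s| := by
  rw [mulExpInvOp, mulExpInvOp, ← cfc_sub _ _ B (continuous_mulExpInv_re _).continuousOn
    (continuous_mulExpInv_re _).continuousOn]
  refine norm_cfc_le (abs_nonneg _) fun z hz => ?_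
  have h := eq_ofReal_of_mem_spectrum h0 h1 hz
  exact norm_mulExpInv_sub_le h.2.1 h.2.2 s τ

theorem norm_mulExpInvOp_mul_sub_le (τ : ℝ) :
    ‖mulExpInvOp B τ * B - B * B + (Complex.I * τ) • (B - B * B)‖ ≤ 2 * τ ^ 2 := by
  have hs : IsStarNormal B := (IsSelfAdjoint.of_nonneg h0).isStarNormal
  have hc := continuous_mulExpInv_re τ
  have h : mulExpInvOp B τ * B - B * B + (Complex.I * τ) • (B - B * B) =
      cfc (fun z : ℂ => mulExpInv τ z.re * z - z * z + Complex.I * τ * (z - z * z)) B := by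
    rw [cfc_add B _ _ (by fun_prop) (by fun_prop), cfc_sub _ _ B (by fun_prop) (by fun_prop),
      cfc_mul _ _ B hc.continuousOn (by fun_prop), cfc_mul _ _ B (by fun_prop) (by fun_prop),
      cfc_const_mul (Complex.I * τ) (fun z : ℂ => z - z * z) B (by fun_prop),
      cfc_sub (fun z : ℂ => z) (fun z : ℂ => z * z) B (by fun_prop) (by fun_prop),
      cfc_mul (fun z : ℂ => z) (fun z : ℂ => z) B (by fun_prop) (by fun_prop), cfc_id' ℂ B]
    rfl
  rw [h]
  refine norm_cfc_le (by positivity) fun z hz => ?_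
  have h := eq_ofReal_of_mem_spectrum h0 h1 hz
  have h2 := norm_mulExpInv_mul_sub_le h.2.1 h.2.2 τ
  rwa [h.1] at h2

theorem hasDerivAt_mulExpInvOp_apply (hd : DenseRange B) (y : H) :
    HasDerivAt (fun τ : ℝ => mulExpInvOp B τ y) (-(Complex.I • (y - B y))) 0 := by
  rw [hasDerivAt_iff_isLittleO, Asymptotics.isLittleO_iff]
  intro c hc
  -- The remainder operator has norm at most `3|τ|` and is quadratic in `τ` on the range of `B`.
  -- Approximating `y` by `B w` within `c / 6` costs `c|τ|/2`; the radius below makes the quadratic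
  -- part at most `c|τ|/2` as well.
  obtain ⟨w, hw⟩ := hd.exists_dist_lt y (ε := c / 6) (by positivity)
  rw [dist_eq_norm] at hw
  have hr : 0 < c / (4 * (‖w‖ + 1)) := by positivity
  filter_upwards [Metric.ball_mem_nhds (0 : ℝ) hr] with τ hτ
  rw [mem_ball_zero_iff, Real.norm_eq_abs] at hτ
  rw [mulExpInvOp_zero h0 h1, sub_zero]
  let D : H →L[ℂ] H := mulExpInvOp B τ - B + (Complex.I * τ) • (1 - B)
  have hD : mulExpInvOp B τ y - B y - τ • -(Complex.I • (y - B y)) = D y := by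
    simp only [D, add_apply, sub_apply,
      smul_apply, one_apply_eq_self, smul_neg, sub_neg_eq_add]
    rw [mul_comm, mul_smul, Complex.coe_smul]
  have hD1 : ‖D‖ ≤ 3 * |τ| := by
    have h2 := norm_mulExpInvOp_sub_le h0 h1 0 τ
    rw [mulExpInvOp_zero h0 h1, sub_zero] at h2
    have h3 : ‖(1 : H →L[ℂ] H) - B‖ ≤ 2 :=
      (norm_sub_le _ _).trans (by
        have : ‖(1 : H →L[ℂ] H)‖ ≤ 1 := ContinuousLinearMap.norm_id_le
        linarith)
    calc ‖D‖ ≤ ‖mulExpInvOp B τ - B‖ + ‖(Complex.I * τ) • (1 - B)‖ := norm_add_le _ _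
      _ ≤ |τ| + |τ| * 2 := by
        rw [norm_smul]
        simp only [norm_mul, Complex.norm_I, one_mul, Complex.norm_real, Real.norm_eq_abs]
        gcongr
      _ = 3 * |τ| := by ring
  have hD2 : ‖D (B w)‖ ≤ 2 * τ ^ 2 * ‖w‖ := by
    have h2 := (mulExpInvOp B τ * B - B * B + (Complex.I * τ) • (B - B * B)).le_of_opNorm_le
      (norm_mulExpInvOp_mul_sub_le h0 h1 τ) w
    exact h2
  rw [hD, Real.norm_eq_abs]
  have h4 : D y = D (y - B w) + D (B w) := by rw [← map_add, sub_add_cancel]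
  have h5 : ‖D (y - B w)‖ ≤ 3 * |τ| * (c / 6) :=
    (D.le_of_opNorm_le hD1 _).trans (by gcongr)
  have h6 : 2 * τ ^ 2 * ‖w‖ ≤ c / 2 * |τ| := by
    rw [lt_div_iff₀ (by positivity)] at hτ
    rw [← sq_abs]
    nlinarith [abs_nonneg τ, norm_nonneg w]
  calc ‖D y‖ ≤ ‖D (y - B w)‖ + ‖D (B w)‖ := h4 ▸ norm_add_le _ _
    _ ≤ c * |τ| := by linarith

omit h0 h1 in
/-- The unitary operator `exp (-iτ(B⁻¹ - 1))`. -/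
noncomputable def expInv (B : H →L[ℂ] H) (τ : ℝ) : H →L[ℂ] H :=
  (mulExpInvOp B τ : H →ₗ[ℂ] H).extendOfNorm (B : H →ₗ[ℂ] H)

variable (hd : DenseRange B)
include hd

theorem expInv_apply (τ : ℝ) (x : H) : expInv B τ (B x) = mulExpInvOp B τ x :=
  LinearMap.extendOfNorm_eq (f := (mulExpInvOp B τ : H →ₗ[ℂ] H)) (e := (B : H →ₗ[ℂ] H)) hd
    ⟨1, fun y => by simpa using (norm_mulExpInvOp_apply h0 h1 τ y).le⟩ x

theorem norm_expInv_apply (τ : ℝ) (x : H) : ‖expInv B τ x‖ = ‖x‖ := by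
  refine hd.induction_on x (isClosed_eq (by fun_prop) (by fun_prop)) fun y => ?_
  rw [expInv_apply h0 h1 hd, norm_mulExpInvOp_apply h0 h1]

theorem expInv_zero : expInv B 0 = 1 := by
  refine ContinuousLinearMap.ext fun x => ?_
  refine hd.induction_on x (isClosed_eq (by fun_prop) (by fun_prop)) fun y => ?_
  rw [expInv_apply h0 h1 hd, mulExpInvOp_zero h0 h1]
  rfl

theorem expInv_add (s τ : ℝ) : expInv B (s + τ) = expInv B s * expInv B τ := by
  -- One factor `B` is consumed by each of the two exponentials, so the identity is checked on
  -- vectors `B (B y)`.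
  have hd2 : DenseRange (B ∘ B) := hd.comp hd B.continuous
  refine ContinuousLinearMap.ext fun x => ?_
  refine hd2.induction_on x (isClosed_eq (by fun_prop) (by fun_prop)) fun y => ?_
  rw [mul_apply_eq_comp, Function.comp_apply, expInv_apply h0 h1 hd,
    expInv_apply h0 h1 hd, mulExpInvOp_comm h0 h1, mulExpInvOp_comm h0 h1, expInv_apply h0 h1 hd]
  exact (DFunLike.congr_fun (mulExpInvOp_mul h0 h1 s τ) y).symm

theorem expInv_mem_unitary (τ : ℝ) : expInv B τ ∈ unitary (H →L[ℂ] H) := by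
  have h : ∀ s, star (expInv B s) * expInv B s = 1 := fun s =>
    (ContinuousLinearMap.norm_map_iff_adjoint_comp_self _).1 (norm_expInv_apply h0 h1 hd s)
  have h2 : expInv B τ * expInv B (-τ) = 1 := by
    rw [← expInv_add h0 h1 hd, add_neg_cancel, expInv_zero h0 h1 hd]
  have h3 : star (expInv B τ) = expInv B (-τ) := left_inv_eq_right_inv (h τ) h2
  rw [Unitary.mem_iff]
  exact ⟨h τ, h3 ▸ h2⟩

theorem continuous_expInv_apply (x : H) : Continuous fun τ : ℝ => expInv B τ x := by
  rw [Metric.continuous_iff]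
  intro s ε hε
  obtain ⟨y, hy⟩ := hd.exists_dist_lt x (ε := ε / 3) (by positivity)
  rw [dist_eq_norm] at hy
  refine ⟨ε / 3 / (‖y‖ + 1), by positivity, fun τ hτ => ?_⟩
  rw [Real.dist_eq, lt_div_iff₀ (by positivity)] at hτ
  rw [dist_eq_norm]
  have h2 : expInv B τ x - expInv B s x =
      expInv B τ (x - B y) - expInv B s (x - B y) + (mulExpInvOp B τ - mulExpInvOp B s) y := by
    rw [sub_apply, ← expInv_apply h0 h1 hd, ← expInv_apply h0 h1 hd, map_sub,
      map_sub]
    abel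
  have h3 : ‖(mulExpInvOp B τ - mulExpInvOp B s) y‖ ≤ |τ - s| * ‖y‖ :=
    ContinuousLinearMap.le_of_opNorm_le _ (norm_mulExpInvOp_sub_le h0 h1 s τ) y
  have h4 := norm_sub_le (expInv B τ (x - B y)) (expInv B s (x - B y))
  rw [norm_expInv_apply h0 h1 hd, norm_expInv_apply h0 h1 hd] at h4
  rw [h2]
  refine (norm_add_le _ _).trans_lt ?_
  nlinarith [abs_nonneg (τ - s)]

/-- Stone's theorem for the selfadjoint operator `A = B⁻¹ - 1`. -/
theorem isUnitaryGroupOf_expInv {A : H →ₗ.[ℂ] H}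
    (hA : ∀ x y, (∃ h : x ∈ A.domain, A ⟨x, h⟩ = y) ↔ x = B (x + y)) :
    IsUnitaryGroupOf A (expInv B) where
  map_zero := expInv_zero h0 h1 hd
  map_add := expInv_add h0 h1 hd
  mem_unitary := expInv_mem_unitary h0 h1 hd
  continuous := continuous_expInv_apply h0 h1 hd
  generator := by
    have hsa : ∀ x y : H, ⟪B x, y⟫_ℂ = ⟪x, B y⟫_ℂ :=
      (IsSelfAdjoint.of_nonneg h0).isSymmetric
    have hderiv : ∀ z : H, HasDerivAt (fun τ : ℝ => expInv B τ (B z))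
        (-(Complex.I • (z - B z))) 0 := by
      intro z
      simp only [expInv_apply h0 h1 hd]
      exact hasDerivAt_mulExpInvOp_apply h0 h1 hd z
    intro x y
    constructor
    · intro h
      have hx : x = B (x + Complex.I • y) := by
        -- Differentiability of the orbit of `x` is exploited weakly: in `⟪B z, U τ x⟫ = ⟪U (-τ) (B
        -- z), x⟫` the right side has a known derivative because `B z` is regular. Comparing
        -- derivatives gives `B y = -i(x - B x)`, which is `x = B (x + iy)`.
        have key : ∀ z : H, ⟪z, B y⟫_ℂ = ⟪z, -(Complex.I • (x - B x))⟫_ℂ := by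
          intro z
          have e1 : HasDerivAt (fun τ : ℝ => ⟪B z, expInv B τ x⟫_ℂ) ⟪B z, y⟫_ℂ 0 := by
            simpa using (hasDerivAt_const (0 : ℝ) (B z)).inner ℂ h
          have e2 : HasDerivAt (fun τ : ℝ => ⟪expInv B (-τ) (B z), x⟫_ℂ)
              ⟪Complex.I • (z - B z), x⟫_ℂ 0 := by
            have e3 : HasDerivAt (fun τ : ℝ => expInv B (-τ) (B z)) (Complex.I • (z - B z)) 0 := by
              have e4 := (neg_zero (G := ℝ)).symm ▸ hderiv z
              simpa [Function.comp_def] using e4.scomp (0 : ℝ) (hasDerivAt_neg (0 : ℝ))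
            have e4 := e3.inner ℂ (hasDerivAt_const (0 : ℝ) x)
            rwa [inner_zero_right, zero_add] at e4
          have e5 : (fun τ : ℝ => ⟪B z, expInv B τ x⟫_ℂ) =
              fun τ : ℝ => ⟪expInv B (-τ) (B z), x⟫_ℂ := by
            funext τ
            have hu := (Unitary.mem_iff.1 (expInv_mem_unitary h0 h1 hd (-τ))).1
            have h2 : ⟪expInv B (-τ) (B z), expInv B (-τ) (expInv B τ x)⟫_ℂ =
                ⟪B z, expInv B τ x⟫_ℂ := by
              rw [← ContinuousLinearMap.adjoint_inner_left, ← ContinuousLinearMap.star_eq_adjoint,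
                ← mul_apply_eq_comp, hu]
              rfl
            rw [← h2, ← mul_apply_eq_comp (expInv B (-τ)) (expInv B τ), ← expInv_add h0 h1 hd, neg_add_cancel,
              expInv_zero h0 h1 hd]
            rfl
          rw [e5] at e1
          have e6 := e1.unique e2
          rw [← hsa, e6, inner_smul_left, inner_sub_left, hsa, inner_neg_right, inner_smul_right,
            inner_sub_right, Complex.conj_I]
          ring
        have key2 : B y = -(Complex.I • (x - B x)) := ext_inner_left ℂ key
        rw [map_add, map_smul, key2, smul_neg, smul_smul, Complex.I_mul_I]
        simp
      obtain ⟨hx1, hx2⟩ := (hA x (Complex.I • y)).2 hx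
      refine ⟨hx1, ?_⟩
      rw [hx2, smul_smul, Complex.I_mul_I]
      simp
    · rintro ⟨hx, rfl⟩
      have h2 := (hA x _).1 ⟨hx, rfl⟩
      have h3 := hderiv (x + A ⟨x, hx⟩)
      rw [← h2, add_sub_cancel_left] at h3
      exact h3

end UnitaryGroup

/-! ### Consequences for `exp (-iτA)` -/

section UnitaryExp

open Filter Topology

variable {H : Type u} [NormedAddCommGroup H] [InnerProductSpace ℂ H] [CompleteSpace H]

/-- Whichever group the choice in `unitaryExp` selects, it satisfies the group axioms, and the
estimates below rest on those alone. -/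
theorem isUnitaryGroupOf_unitaryExp {K : Type v} [NormedAddCommGroup K] [InnerProductSpace ℂ K]
    [CompleteSpace K] {T : H →ₗ.[ℂ] K} (hd : Dense (T.domain : Set H)) (hT : T.IsClosed) :
    IsUnitaryGroupOf (opComp T.adjoint T) (unitaryExp (opComp T.adjoint T)) := by
  obtain ⟨B, hB⟩ := exists_isFormResolvent hT
  have h : ∃ U : ℝ → H →L[ℂ] H, IsUnitaryGroupOf (opComp T.adjoint T) U :=
    ⟨_, isUnitaryGroupOf_expInv hB.nonneg hB.norm_le_one (hB.denseRange hd)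
      fun _ _ => hB.mem_opComp_iff hd⟩
  have h2 : unitaryExp (opComp T.adjoint T) = h.choose := by
    funext τ
    simp only [unitaryExp, dif_pos h]
  rw [h2]
  exact h.choose_spec

namespace IsUnitaryGroupOf

variable {A : H →ₗ.[ℂ] H} {U : ℝ → H →L[ℂ] H}

theorem norm_apply (hU : IsUnitaryGroupOf A U) (τ : ℝ) (x : H) : ‖U τ x‖ = ‖x‖ :=
  (ContinuousLinearMap.norm_map_iff_adjoint_comp_self _).2
    (Unitary.mem_iff.1 (hU.mem_unitary τ)).1 x

theorem apply_add (hU : IsUnitaryGroupOf A U) (s τ : ℝ) (x : H) : U (s + τ) x = U s (U τ x) := by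
  rw [hU.map_add]
  rfl

theorem tendsto_apply (hU : IsUnitaryGroupOf A U) {ι : Type*} {l : Filter ι} {s : ι → ℝ} {z : ι → H}
    {s₀ : ℝ} {z₀ : H} (hs : Tendsto s l (𝓝 s₀)) (hz : Tendsto z l (𝓝 z₀)) :
    Tendsto (fun i => U (s i) (z i)) l (𝓝 (U s₀ z₀)) := by
  have h1 : Tendsto (fun i => U (s i) z₀) l (𝓝 (U s₀ z₀)) :=
    ((hU.continuous z₀).tendsto s₀).comp hs
  have h2 : Tendsto (fun i => U (s i) (z i - z₀)) l (𝓝 0) := by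
    rw [tendsto_zero_iff_norm_tendsto_zero]
    simp only [hU.norm_apply]
    rw [← tendsto_zero_iff_norm_tendsto_zero]
    simpa using hz.sub_const z₀
  simpa using h1.add h2

/-- An approximate solution of `w' = -iAw` is close to the exact one. -/
theorem norm_sub_apply_le (hU : IsUnitaryGroupOf A U) {w w' : ℝ → H} {E : ℝ}
    (hw : ∀ τ, HasDerivAt w (w' τ) τ) (hmem : ∀ τ, w τ ∈ A.domain)
    (hE : ∀ τ, ‖w' τ + Complex.I • A ⟨w τ, hmem τ⟩‖ ≤ E) (τ : ℝ) :
    ‖w τ - U τ (w 0)‖ ≤ E * |τ| := by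
  have hf : ∀ s, HasDerivAt (fun s => U (-s) (w s))
      (U (-s) (w' s + Complex.I • A ⟨w s, hmem s⟩)) s := by
    intro s
    -- The product rule is unavailable, as the group is only strongly differentiable on the domain.
    -- The increment is regrouped as `U (-(s + h))` applied to `w (s + h) - U h (w s)`, where `w s`
    -- lies in the domain of `A`.
    have hq : HasDerivAt (fun h => w (s + h) - U h (w s))
        (w' s + Complex.I • A ⟨w s, hmem s⟩) 0 := by
      have h1 : HasDerivAt (fun h => w (s + h)) (w' s) 0 := by
        have h2 : HasDerivAt w (w' s) (s + 0) := by simpa using hw s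
        exact h2.comp_const_add s 0
      have h3 : HasDerivAt (fun h : ℝ => U h (w s)) (-(Complex.I • A ⟨w s, hmem s⟩)) 0 :=
        (hU.generator _ _).2 ⟨hmem s, rfl⟩
      simpa using h1.fun_sub h3
    rw [hasDerivAt_iff_tendsto_slope_zero] at hq ⊢
    have h4 : Tendsto (fun h : ℝ => -(s + h)) (𝓝[≠] 0) (𝓝 (-s)) := by
      have h5 : Tendsto (fun h : ℝ => -(s + h)) (𝓝 0) (𝓝 (-(s + 0))) :=
        Continuous.tendsto (by fun_prop) _
      rw [add_zero] at h5
      exact h5.mono_left nhdsWithin_le_nhds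
    refine (hU.tendsto_apply h4 hq).congr fun h => ?_
    have h6 : U (-(s + h)) (U h (w s)) = U (-s) (w s) := by
      rw [← hU.apply_add]
      congr 2
      ring
    have h7 : U 0 (w s) = w s := by rw [hU.map_zero]; rfl
    rw [zero_add, add_zero, h7, sub_self, sub_zero, ← Complex.coe_smul, map_smul, map_sub, h6,
      Complex.coe_smul]
  have h1 := convex_univ.norm_image_sub_le_of_norm_hasDerivWithin_le
    (fun s _ => (hf s).hasDerivWithinAt) (C := E)
    (fun s _ => (hU.norm_apply _ _).trans_le (hE s)) (Set.mem_univ 0) (Set.mem_univ τ)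
  rw [sub_zero, Real.norm_eq_abs] at h1
  refine le_trans (le_of_eq ?_) h1
  rw [← hU.norm_apply (-τ), map_sub, ← hU.apply_add, neg_add_cancel, neg_zero]

end IsUnitaryGroupOf

end UnitaryExp

/-! ### The spectral gap -/

section Gap

variable {H : Type u} {K : Type v}
  [NormedAddCommGroup H] [InnerProductSpace ℂ H] [CompleteSpace H]
  [NormedAddCommGroup K] [InnerProductSpace ℂ K]
  {T : H →ₗ.[ℂ] K} {B : H →L[ℂ] H}

namespace IsFormResolvent

theorem inv_sub_one_mem_opSpectrum (hB : IsFormResolvent T B) (hT : Dense (T.domain : Set H))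
    {r : ℝ} (hr : r ∈ spectrum ℝ B) (hr0 : r ≠ 0) :
    ((r⁻¹ - 1 : ℝ) : ℂ) ∈ opSpectrum (opComp T.adjoint T) := by
  rintro ⟨R, hR1, hR2⟩
  refine hr ?_
  have hrc : (r : ℂ) ≠ 0 := by exact_mod_cast hr0
  have h1 : ∀ y, R y = B y + (r : ℂ)⁻¹ • B (R y) := by
    intro y
    obtain ⟨h, hy⟩ := hR2 y
    have h2 := (hB.mem_opComp_iff hT).1 ⟨h, rfl⟩
    rw [sub_eq_iff_eq_add.1 hy] at h2
    conv_lhs => rw [h2]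
    rw [map_add, map_add, map_smul]
    push_cast
    rw [sub_smul, one_smul]
    abel
  have h3 : ∀ f, R f - (r : ℂ)⁻¹ • R (B f) = B f := by
    intro f
    obtain ⟨h, hf⟩ := (hB.mem_opComp_iff hT (x := B f) (y := f - B f)).2
      (by rw [add_sub_cancel])
    have h4 := hR1 ⟨B f, h⟩
    rw [hf] at h4
    push_cast at h4
    conv_rhs => rw [← h4]
    rw [map_sub, map_sub, map_smul, sub_smul, one_smul]
    abel
  have hal : ∀ x : H, (algebraMap ℝ (H →L[ℂ] H) r) x = (r : ℂ) • x := fun x => by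
    rw [Algebra.algebraMap_eq_smul_one]
    simp
  -- With `z = 1/r - 1` one has `A - z = B⁻¹ - r⁻¹`, so `(r - B)⁻¹ = r⁻¹ (A - z)⁻¹ B⁻¹`, and `B⁻¹ =
  -- (A - z) + r⁻¹` gives this formula.
  let V : H →L[ℂ] H := (r : ℂ)⁻¹ • (1 + (r : ℂ)⁻¹ • R)
  have hV : ∀ x, V x = (r : ℂ)⁻¹ • (x + (r : ℂ)⁻¹ • R x) := fun x => rfl
  refine ⟨⟨algebraMap ℝ (H →L[ℂ] H) r - B, V, ?_, ?_⟩, rfl⟩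
  · ext y
    change (algebraMap ℝ (H →L[ℂ] H) r) (V y) - B (V y) = y
    rw [hal, hV, smul_inv_smul₀ hrc, map_smul, map_add, map_smul, ← h1 y, add_sub_cancel_right]
  · ext f
    change V ((algebraMap ℝ (H →L[ℂ] H) r) f - B f) = f
    rw [hal, hV, map_sub, map_smul, smul_sub, inv_smul_smul₀ hrc]
    have h5 : (r : ℂ) • f - B f + (R f - (r : ℂ)⁻¹ • R (B f)) = (r : ℂ) • f := by rw [h3]; abel
    rw [h5, inv_smul_smul₀ hrc]

theorem mem_opKer_of_apply_eq (hB : IsFormResolvent T B) (hT : Dense (T.domain : Set H)) {x : H}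
    (hx : B x = x) : x ∈ opKer T := by
  obtain ⟨h, hv⟩ := (mem_opComp_adjoint_self_iff hT (x := x) (y := 0)).1
    ((hB.mem_opComp_iff hT).2 (by rw [add_zero, hx]))
  refine ⟨⟨x, h⟩, ?_, rfl⟩
  have h2 := hv ⟨x, h⟩
  rw [inner_zero_left, inner_self_eq_zero] at h2
  exact h2

/-- A continuous `h` that vanishes up to `κ` and equals `1` at `1` replaces the spectral projection:
`h(B)` maps into the kernel of `T`, hence kills `u`, and `r ≤ κ + (1 - κ) h(r)` becomes the operator
inequality. -/
theorem re_inner_apply_self_le (hB : IsFormResolvent T B) (hT : Dense (T.domain : Set H)) {κ : ℝ}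
    (hκ : κ < 1) (hs : ∀ r ∈ spectrum ℝ B, r ≤ κ ∨ r = 1) {u : H} (hu : u ∈ (opKer T)ᗮ) :
    (⟪B u, u⟫_ℂ).re ≤ κ * ‖u‖ ^ 2 := by
  have hκ' : 1 - κ ≠ 0 := by linarith
  have hsa : IsSelfAdjoint B := hB.isSelfAdjoint
  let h : ℝ → ℝ := fun r => max 0 ((r - κ) / (1 - κ))
  have hc : Continuous h := by fun_prop
  let e : H →L[ℂ] H := cfc h B
  have he : IsSelfAdjoint e := cfc_predicate h B
  have hBe : B * e = e := by
    have h1 : B * e = cfc (fun r : ℝ => r * h r) B := by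
      rw [cfc_mul _ _ B (by fun_prop) hc.continuousOn, cfc_id' ℝ B]
    rw [h1]
    refine cfc_congr fun r hr => ?_
    rcases hs r hr with h2 | rfl
    · have : h r = 0 := max_eq_left (div_nonpos_of_nonpos_of_nonneg (by linarith) (by linarith))
      simp only [this, mul_zero]
    · simp only [one_mul]
  have heu : e u = 0 := by
    refine ext_inner_left ℂ fun y => ?_
    have h1 : e y ∈ opKer T :=
      hB.mem_opKer_of_apply_eq hT (DFunLike.congr_fun hBe y)
    have h2 : ⟪e y, u⟫_ℂ = ⟪y, e u⟫_ℂ := he.isSymmetric y u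
    rw [← h2, inner_zero_right]
    exact Submodule.inner_right_of_mem_orthogonal h1 hu
  have hC : 0 ≤ cfc (fun r : ℝ => κ + (1 - κ) * h r - r) B := by
    refine cfc_nonneg fun r _ => ?_
    have h1 : (r - κ) / (1 - κ) ≤ h r := le_max_right _ _
    rw [div_le_iff₀ (by linarith)] at h1
    linarith
  have hC2 : cfc (fun r : ℝ => κ + (1 - κ) * h r - r) B =
      algebraMap ℝ _ κ + (1 - κ) • e - B := by
    rw [cfc_sub _ _ B (by fun_prop) (by fun_prop), cfc_const_add _ _ B (by fun_prop),
      cfc_const_mul _ _ B (by fun_prop), cfc_id' ℝ B]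
  rw [hC2, ContinuousLinearMap.nonneg_iff_isPositive] at hC
  have h3 := hC.re_inner_nonneg_left u
  have h4 : (algebraMap ℝ (H →L[ℂ] H) κ + (1 - κ) • e - B) u = (κ : ℂ) • u - B u := by
    rw [Algebra.algebraMap_eq_smul_one]
    simp [heu]
  rw [h4, inner_sub_left, inner_smul_left, map_sub, Complex.conj_ofReal, RCLike.re_eq_complex_re,
    Complex.re_ofReal_mul] at h3
  have h5 : (⟪u, u⟫_ℂ).re = ‖u‖ ^ 2 := inner_self_eq_norm_sq (𝕜 := ℂ) u
  rw [h5] at h3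
  linarith

end IsFormResolvent

/-- If the nonzero spectrum of `T^* T` is at distance at least `m` from `0`, then
`‖T u‖² ≥ m ‖u‖²` on the orthogonal complement of the kernel. -/
theorem mul_norm_sq_le_of_opSpectrum [CompleteSpace K] (hd : Dense (T.domain : Set H))
    (hT : T.IsClosed) {m : ℝ} (hm : 0 < m)
    (hs : ∀ z ∈ opSpectrum (opComp T.adjoint T), z ≠ 0 → m ≤ ‖z‖) (u : T.domain)
    (hu : (u : H) ∈ (opKer T)ᗮ) : m * ‖(u : H)‖ ^ 2 ≤ ‖T u‖ ^ 2 := by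
  obtain ⟨B, hB⟩ := exists_isFormResolvent hT
  have hκ : (1 + m)⁻¹ < 1 := inv_lt_one_of_one_lt₀ (by linarith)
  have hsp : ∀ r ∈ spectrum ℝ B, r ≤ (1 + m)⁻¹ ∨ r = 1 := by
    intro r hr
    rcases le_or_gt r 0 with h0 | h0
    · exact Or.inl (h0.trans (by positivity))
    by_cases h1 : r = 1
    · exact Or.inr h1
    left
    have hr1 : r ≤ 1 := by
      refine (Real.le_norm_self r).trans ((spectrum.norm_le_norm_mul_of_mem hr).trans ?_)
      exact mul_le_one₀ hB.norm_le_one (norm_nonneg _) ContinuousLinearMap.norm_id_le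
    have hne : r⁻¹ - 1 ≠ 0 := by
      rw [sub_ne_zero]
      intro h
      exact h1 (inv_eq_one.1 h)
    have h2 := hs _ (hB.inv_sub_one_mem_opSpectrum hd hr h0.ne') (by exact_mod_cast hne)
    rw [Complex.norm_real, Real.norm_of_nonneg (sub_nonneg.2 ((one_le_inv₀ h0).2 hr1))] at h2
    rw [le_inv_comm₀ h0 (by linarith)]
    linarith
  have h1 := hB.re_inner_apply_self_le hd hκ hsp hu
  rw [hB.inner_apply_self_re, Complex.ofReal_re] at h1
  -- The weak equation is tested with `u` itself. Cauchy–Schwarz in `K × H` and the bound on `⟪B u,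
  -- u⟫` then give `‖u‖² ≤ (1 + m)⁻¹ (‖T u‖² + ‖u‖²)`.
  have h2 : ‖(u : H)‖ ^ 2 ≤ ‖T ⟨B u, hB.mem u⟩‖ * ‖T u‖ + ‖B u‖ * ‖(u : H)‖ := by
    have h3 := congrArg norm (hB.inner_eq u u)
    rw [inner_self_eq_norm_sq_to_K, norm_pow, RCLike.norm_ofReal, abs_norm] at h3
    rw [← h3]
    exact (norm_add_le _ _).trans (add_le_add (norm_inner_le_norm _ _) (norm_inner_le_norm _ _))
  generalize ‖T ⟨B u, hB.mem u⟩‖ = a at h1 h2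
  generalize ‖T u‖ = b at *
  generalize ‖B (u : H)‖ = c at *
  have hn := norm_nonneg (u : H)
  generalize ‖(u : H)‖ = n at *
  rcases hn.eq_or_lt with rfl | hn
  · nlinarith [sq_nonneg b]
  have h4 : (n ^ 2) ^ 2 ≤ (a * b + c * n) ^ 2 := pow_le_pow_left₀ (by positivity) h2 2
  have h5 : (a * b + c * n) ^ 2 ≤ (a ^ 2 + c ^ 2) * (b ^ 2 + n ^ 2) := by
    nlinarith [sq_nonneg (a * n - c * b)]
  have h6 : (n ^ 2) ^ 2 ≤ (1 + m)⁻¹ * n ^ 2 * (b ^ 2 + n ^ 2) :=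
    h4.trans (h5.trans (by gcongr))
  have h7 : n ^ 2 ≤ (1 + m)⁻¹ * (b ^ 2 + n ^ 2) := by
    have : 0 < n ^ 2 := by positivity
    nlinarith
  rw [inv_mul_eq_div, le_div_iff₀ (by linarith)] at h7
  linarith

end Gap

/-! ### Weak equations on the range of a closed operator -/

section WeakEquation

open Filter Topology

variable {H : Type u} {K : Type v}
  [NormedAddCommGroup H] [InnerProductSpace ℂ H] [CompleteSpace H]
  [NormedAddCommGroup K] [InnerProductSpace ℂ K] [CompleteSpace K]

/-- An operator that is bounded from above and below by the graph norm of a closed operator has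
closed range. -/
theorem isClosed_map_of_isClosed_graph {F : Type*} [NormedAddCommGroup F] [NormedSpace ℂ F]
    {T : H →ₗ.[ℂ] K} (hT : T.IsClosed) {M : Submodule ℂ H} (hM : IsClosed (M : Set H))
    (L : T.domain →ₗ[ℂ] F) {C c : ℝ}
    (hb : ∀ u, ‖L u‖ ≤ C * (‖(u : H)‖ + ‖T u‖))
    (hc : ∀ u : T.domain, (u : H) ∈ M → ‖(u : H)‖ + ‖T u‖ ≤ c * ‖L u‖) :
    IsClosed ((M.comap T.domain.subtype).map L : Set F) := by
  rw [← isSeqClosed_iff_isClosed]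
  intro y y₀ hy hlim
  choose u hu huy using hy
  have hg : CauchySeq fun n => ((u n : H), T (u n)) := by
    have hy' := hlim.cauchySeq
    rw [Metric.cauchySeq_iff] at hy' ⊢
    intro ε hε
    obtain ⟨N, hN⟩ := hy' (ε / (|c| + 1)) (by positivity)
    refine ⟨N, fun m hm n hn => ?_⟩
    have h1 := hN m hm n hn
    rw [dist_eq_norm, ← huy, ← huy, ← map_sub, lt_div_iff₀ (by positivity)] at h1
    have h2 := hc (u m - u n) (M.sub_mem (hu m) (hu n))
    rw [T.map_sub] at h2
    have h3 : c * ‖L (u m - u n)‖ ≤ |c| * ‖L (u m - u n)‖ := by gcongr; exact le_abs_self c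
    rw [Prod.dist_eq, dist_eq_norm, dist_eq_norm]
    change ‖(u m : H) - u n‖ + _ ≤ _ at h2
    refine max_lt ?_ ?_ <;>
      nlinarith [norm_nonneg ((u m : H) - u n), norm_nonneg (T (u m) - T (u n)),
        norm_nonneg (L (u m - u n))]
  obtain ⟨g, hg⟩ := cauchySeq_tendsto_of_complete hg
  have hgT : g ∈ T.graph := hT.mem_of_tendsto hg (Eventually.of_forall fun n => T.mem_graph _)
  obtain ⟨w, hw1, hw2⟩ := T.mem_graph_iff.1 hgT
  have hl1 : Tendsto (fun n => (u n : H)) atTop (𝓝 w) :=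
    hw1 ▸ (continuous_fst.tendsto g).comp hg
  have hl2 : Tendsto (fun n => T (u n)) atTop (𝓝 (T w)) :=
    hw2 ▸ (continuous_snd.tendsto g).comp hg
  refine ⟨w, hM.mem_of_tendsto hl1 (Eventually.of_forall hu), ?_⟩
  refine tendsto_nhds_unique ?_ hlim
  rw [tendsto_iff_norm_sub_tendsto_zero]
  have hl3 : Tendsto (fun n => C * (‖(u n : H) - w‖ + ‖T (u n) - T w‖)) atTop (𝓝 0) := by
    have := ((tendsto_iff_norm_sub_tendsto_zero.1 hl1).add
      (tendsto_iff_norm_sub_tendsto_zero.1 hl2)).const_mul C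
    simpa using this
  refine squeeze_zero (fun _ => norm_nonneg _) (fun n => ?_) hl3
  rw [← huy, ← map_sub, ← T.map_sub]
  exact hb (u n - w)

omit [CompleteSpace H] in
-- The solution is minus the preimage under `L` of the orthogonal projection of `f ω` onto the
-- closed space `L(D)`; injectivity on `D` makes it linear in `ω`.
theorem exists_weak_solution {V E : Type*} [AddCommGroup V] [Module ℂ V] [AddCommGroup E]
    [Module ℂ E] (L : V →ₗ[ℂ] K) (D : Submodule ℂ V) (hD : IsClosed (D.map L : Set K))
    (hinj : ∀ u ∈ D, L u = 0 → u = 0) (f : E →ₗ[ℂ] K) :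
    ∃ Y : E →ₗ[ℂ] V, ∀ ω, Y ω ∈ D ∧ ∀ ζ ∈ D, ⟪L (Y ω) + f ω, L ζ⟫_ℂ = 0 := by
  have : CompleteSpace (D.map L) := hD.completeSpace_coe
  have hb : Function.Bijective (L.submoduleMap D) := by
    refine ⟨(injective_iff_map_eq_zero _).2 fun u hu => ?_, L.submoduleMap_surjective D⟩
    exact Subtype.ext (hinj u u.2 (congrArg Subtype.val hu))
  let e := LinearEquiv.ofBijective (L.submoduleMap D) hb
  let Q : E →ₗ[ℂ] D.map L := ((D.map L).orthogonalProjectionOnto : K →ₗ[ℂ] D.map L) ∘ₗ f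
  refine ⟨-(D.subtype ∘ₗ (e.symm : D.map L →ₗ[ℂ] D) ∘ₗ Q), fun ω => ?_⟩
  have h1 : L (e.symm (Q ω)) = Q ω := congrArg Subtype.val (e.apply_symm_apply (Q ω))
  refine ⟨D.neg_mem (e.symm (Q ω)).2, fun ζ hζ => ?_⟩
  have h2 : (D.map L).starProjection (f ω) = Q ω := rfl
  have h3 := Submodule.starProjection_inner_eq_zero (K := D.map L) (f ω) (L ζ)
    (Submodule.mem_map_of_mem hζ)
  change ⟪L (-(e.symm (Q ω) : V)) + f ω, L ζ⟫_ℂ = 0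
  rw [map_neg, h1, ← h2, neg_add_eq_sub]
  exact h3

end WeakEquation

/-! ### The pencil on `Dom X_0` -/

theorem LinearPMap.mem_graph_finset_sum {ι R E F : Type*} [Ring R] [AddCommGroup E] [Module R E]
    [AddCommGroup F] [Module R F] (s : Finset ι) (f : ι → E →ₗ.[R] F) (x : E) (y : ι → F)
    (h : ∀ i ∈ s, (x, y i) ∈ (f i).graph) : (x, ∑ i ∈ s, y i) ∈ (∑ i ∈ s, f i).graph := by
  classical
  induction s using Finset.induction_on with
  | empty => exact (0 : E →ₗ.[R] F).mem_graph ⟨x, trivial⟩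
  | insert a s ha ih =>
    rw [Finset.sum_insert ha, Finset.sum_insert ha]
    obtain ⟨u, hu, hu'⟩ := (LinearPMap.mem_graph_iff _).1 (h a (Finset.mem_insert_self a s))
    obtain ⟨v, hv, hv'⟩ := (LinearPMap.mem_graph_iff _).1
      (ih fun i hi => h i (Finset.mem_insert_of_mem hi))
    dsimp only at hu hu' hv hv'
    have hx1 : x ∈ (f a).domain := hu ▸ u.2
    have hx2 : x ∈ (∑ i ∈ s, f i).domain := hv ▸ v.2
    refine (LinearPMap.mem_graph_iff _).2 ⟨⟨x, hx1, hx2⟩, rfl, ?_⟩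
    rw [LinearPMap.add_apply, ← hu', ← hv']
    congr 2 <;> exact Subtype.ext (by simp [hu, hv])

namespace OperatorPencil

variable {H : Type u} {K : Type v}
  [NormedAddCommGroup H] [InnerProductSpace ℂ H] [CompleteSpace H]
  [NormedAddCommGroup K] [InnerProductSpace ℂ K] [CompleteSpace K]
  {p : ℕ} (𝒳 : OperatorPencil p H K)

/-- The restriction of `X_j` to `Dom X_0`. -/
noncomputable def coeff (j : ℕ) : (𝒳.X 0).domain →ₗ[ℂ] K :=
  if h : j ≤ p then (𝒳.X j).toFun ∘ₗ Submodule.inclusion (𝒳.domain_le j h) else 0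

/-- The pencil `X(t)` as a linear map on `Dom X_0`. -/
noncomputable def map (t : ℝ) : (𝒳.X 0).domain →ₗ[ℂ] K :=
  ∑ j ∈ Finset.range (p + 1), ((t : ℂ) ^ j) • 𝒳.coeff j

variable {𝒳}

theorem coeff_apply {j : ℕ} (hj : j ≤ p) (u : (𝒳.X 0).domain) :
    𝒳.coeff j u = 𝒳.X j ⟨u, 𝒳.domain_le j hj u.2⟩ := by
  rw [coeff, dif_pos hj]
  rfl

theorem coeff_zero (u : (𝒳.X 0).domain) : 𝒳.coeff 0 u = 𝒳.X 0 u := coeff_apply p.zero_le u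

theorem coeff_self (u : (𝒳.X 0).domain) : 𝒳.coeff p u = 𝒳.Xp u := by
  -- Stated for a general `T`, because the equation for `X p` cannot be rewritten under the
  -- dependent domain.
  have h : ∀ (T : H →ₗ.[ℂ] K) (hT : T = (𝒳.Xp : H →ₗ[ℂ] K).toPMap ⊤) (x : H) (hx : x ∈ T.domain),
      T ⟨x, hx⟩ = 𝒳.Xp x := by
    rintro _ rfl x hx
    rfl
  rw [coeff_apply le_rfl]
  exact h _ 𝒳.X_p_eq _ _

theorem norm_coeff_le {j : ℕ} (hj : j < p) (u : (𝒳.X 0).domain) :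
    ‖𝒳.coeff j u‖ ≤ 𝒳.C₀ * ‖𝒳.X 0 u‖ := by
  rw [coeff_apply hj.le]
  exact 𝒳.norm_le j hj u

theorem pencil_apply (t : ℝ) (u : H) (h : u ∈ (pencil p 𝒳.X t).domain) (h' : u ∈ (𝒳.X 0).domain) :
    pencil p 𝒳.X t ⟨u, h⟩ = 𝒳.map t ⟨u, h'⟩ := by
  have h1 : (u, ∑ j ∈ Finset.range (p + 1), ((t : ℂ) ^ j) • 𝒳.coeff j ⟨u, h'⟩) ∈
      (pencil p 𝒳.X t).graph := by
    refine LinearPMap.mem_graph_finset_sum _ _ _ _ fun j hj => ?_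
    have hj' : j ≤ p := Nat.lt_succ_iff.1 (Finset.mem_range.1 hj)
    rw [coeff_apply hj']
    exact LinearPMap.mem_graph (((t : ℂ) ^ j) • 𝒳.X j) ⟨u, 𝒳.domain_le j hj' h'⟩
  have h2 : 𝒳.map t ⟨u, h'⟩ = ∑ j ∈ Finset.range (p + 1), ((t : ℂ) ^ j) • 𝒳.coeff j ⟨u, h'⟩ := by
    simp [map]
  rw [h2]
  exact (pencil p 𝒳.X t).mem_graph_snd_inj ((pencil p 𝒳.X t).mem_graph ⟨u, h⟩) h1 rfl

theorem map_zero_eq (u : (𝒳.X 0).domain) : 𝒳.map 0 u = 𝒳.X 0 u := by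
  rw [map, Finset.sum_range_succ', ← coeff_zero]
  simp

theorem map_eq (t : ℝ) (u : (𝒳.X 0).domain) :
    𝒳.map t u = 𝒳.X 0 u + ∑ j ∈ Finset.Ico 1 p, ((t : ℂ) ^ j) • 𝒳.coeff j u +
      ((t : ℂ) ^ p) • 𝒳.Xp u := by
  have hp : 0 < p := two_pos.trans_le 𝒳.two_le
  simp only [map, LinearMap.sum_apply, LinearMap.smul_apply]
  rw [Finset.sum_range_succ, coeff_self, Finset.range_eq_Ico, Finset.sum_eq_sum_Ico_succ_bot hp,
    coeff_zero]
  simp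

theorem norm_sum_Ico_coeff_le {t : ℝ} (ht : |t| ≤ 1) (k : ℕ) (u : (𝒳.X 0).domain) :
    ‖∑ j ∈ Finset.Ico k p, ((t : ℂ) ^ j) • 𝒳.coeff j u‖ ≤
      ((p - k : ℕ) : ℝ) * (|t| ^ k * (𝒳.C₀ * ‖𝒳.X 0 u‖)) := by
  rw [← Nat.card_Ico, ← nsmul_eq_mul]
  refine norm_sum_le_of_le _ (fun j hj => ?_) |>.trans (by rw [Finset.sum_const])
  rw [Finset.mem_Ico] at hj
  rw [norm_smul, norm_pow, Complex.norm_real, Real.norm_eq_abs]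
  have := norm_coeff_le hj.2 u
  exact mul_le_mul (pow_le_pow_of_le_one (abs_nonneg _) ht hj.1) this (norm_nonneg _)
    (by positivity)

theorem norm_map_sub_le {t : ℝ} (ht : |t| ≤ 1) (u : (𝒳.X 0).domain) :
    ‖𝒳.map t u - 𝒳.X 0 u‖ ≤
      |t| * (((p : ℝ) - 1) * 𝒳.C₀) * ‖𝒳.X 0 u‖ + |t| * (‖𝒳.Xp‖ * ‖(u : H)‖) := by
  have hp : 1 ≤ p := one_le_two.trans 𝒳.two_le
  have h1 := norm_sum_Ico_coeff_le ht 1 u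
  rw [Nat.cast_sub hp, pow_one, Nat.cast_one] at h1
  have h2 : ‖((t : ℂ) ^ p) • 𝒳.Xp u‖ ≤ |t| * (‖𝒳.Xp‖ * ‖(u : H)‖) := by
    rw [norm_smul, norm_pow, Complex.norm_real, Real.norm_eq_abs]
    exact mul_le_mul (pow_le_of_le_one (abs_nonneg _) ht (by omega)) (𝒳.Xp.le_opNorm _)
      (norm_nonneg _) (abs_nonneg _)
  rw [map_eq, add_assoc, add_sub_cancel_left]
  refine (norm_add_le _ _).trans ?_
  linarith

theorem norm_map_sub_sub_le {t : ℝ} (ht : |t| ≤ 1) (u : (𝒳.X 0).domain) :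
    ‖𝒳.map t u - 𝒳.X 0 u - (t : ℂ) • 𝒳.coeff 1 u‖ ≤
      t ^ 2 * ((p * 𝒳.C₀) * ‖𝒳.X 0 u‖ + ‖𝒳.Xp‖ * ‖(u : H)‖) := by
  have hp : 1 < p := 𝒳.two_le
  have hC := 𝒳.one_le_C₀
  have h1 := norm_sum_Ico_coeff_le ht 2 u
  have h3 : (((p - 2 : ℕ) : ℝ)) * (|t| ^ 2 * (𝒳.C₀ * ‖𝒳.X 0 u‖)) ≤
      p * (|t| ^ 2 * (𝒳.C₀ * ‖𝒳.X 0 u‖)) := by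
    gcongr
    omega
  have h2 : ‖((t : ℂ) ^ p) • 𝒳.Xp u‖ ≤ |t| ^ 2 * (‖𝒳.Xp‖ * ‖(u : H)‖) := by
    rw [norm_smul, norm_pow, Complex.norm_real, Real.norm_eq_abs]
    exact mul_le_mul (pow_le_pow_of_le_one (abs_nonneg _) ht 𝒳.two_le) (𝒳.Xp.le_opNorm _)
      (norm_nonneg _) (by positivity)
  rw [map_eq, Finset.sum_eq_sum_Ico_succ_bot hp, pow_one]
  have h4 : ∀ a b c d : K, a + (b + c) + d - a - b = c + d := fun a b c d => by abel
  rw [h4]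
  refine (norm_add_le _ _).trans ?_
  rw [sq_abs] at *
  linarith

theorem mem_N_iff {x : H} : x ∈ 𝒳.N ↔ ∃ h : x ∈ (𝒳.X 0).domain, 𝒳.X 0 ⟨x, h⟩ = 0 := by
  constructor
  · rintro ⟨y, hy, rfl⟩
    exact ⟨y.2, hy⟩
  · rintro ⟨h, hx⟩
    exact ⟨⟨x, h⟩, hx, rfl⟩

variable (𝒳) in
/-- The inclusion of `𝔑` into `Dom X_0`. -/
noncomputable def inclN : 𝒳.N →ₗ[ℂ] (𝒳.X 0).domain :=
  Submodule.inclusion fun _ hx => (mem_N_iff.1 hx).1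

theorem coe_inclN (ω : 𝒳.N) : (𝒳.inclN ω : H) = ω := rfl

theorem X_zero_inclN (ω : 𝒳.N) : 𝒳.X 0 (𝒳.inclN ω) = 0 := (mem_N_iff.1 ω.2).2

/-- The bounds `‖X_j u‖ ≤ C₀ ‖X_0 u‖` annihilate every intermediate coefficient on `𝔑`; this is why
the reduced problem starts at order `t^p`. -/
theorem map_inclN (t : ℝ) (ω : 𝒳.N) : 𝒳.map t (𝒳.inclN ω) = ((t : ℂ) ^ p) • 𝒳.Xp ω := by
  rw [map_eq, X_zero_inclN, coe_inclN, Finset.sum_eq_zero, zero_add, zero_add]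
  intro j hj
  have := norm_coeff_le (Finset.mem_Ico.1 hj).2 (𝒳.inclN ω)
  rw [X_zero_inclN, norm_zero, mul_zero, norm_le_zero_iff] at this
  rw [this, smul_zero]

theorem isClosed_N_orthogonal : IsClosed (𝒳.Nᗮ : Set H) := 𝒳.N.isClosed_orthogonal

variable (𝒳) in
/-- `Dom X_0 ∩ 𝔑^⊥` as a subspace of `Dom X_0`. -/
noncomputable def domPerp : Submodule ℂ (𝒳.X 0).domain := 𝒳.Nᗮ.comap (𝒳.X 0).domain.subtype

theorem coe_toN (x : H) : (𝒳.toN x : H) = 𝒳.P x := rfl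

theorem toN_coe (ω : 𝒳.N) : 𝒳.toN ω = ω :=
  𝒳.N.orthogonalProjectionOnto_mem_subspace_eq_self ω

theorem norm_toN_le (x : H) : ‖𝒳.toN x‖ ≤ ‖x‖ :=
  𝒳.N.norm_orthogonalProjectionOnto_apply_le x

theorem sub_inclN_mem_domPerp (v : (𝒳.X 0).domain) : v - 𝒳.inclN (𝒳.toN v) ∈ 𝒳.domPerp :=
  𝒳.N.sub_starProjection_mem_orthogonal (v : H)

theorem inner_toN (ω : 𝒳.N) (x : H) : ⟪ω, 𝒳.toN x⟫_ℂ = ⟪(ω : H), x⟫_ℂ := by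
  have h := 𝒳.N.sub_starProjection_mem_orthogonal x
  have h2 := Submodule.inner_right_of_mem_orthogonal ω.2 h
  rw [inner_sub_right, sub_eq_zero] at h2
  exact h2.symm

/-- The smallness conditions on `t`, together with the spectral gap, for `s = δ ^ (1/2)`. -/
structure Small (𝒳 : OperatorPencil p H K) (s t : ℝ) : Prop where
  pos : 0 < s
  le_one : s ≤ 1
  abs_le : |t| ≤ 1
  mul_C₀_le : |t| * (((p : ℝ) - 1) * 𝒳.C₀) ≤ 1 / 2
  mul_Xp_le : |t| * ‖𝒳.Xp‖ ≤ s
  gap : ∀ u ∈ 𝒳.domPerp, 6 * s * ‖(u : H)‖ ≤ ‖𝒳.X 0 u‖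

namespace Small

variable {s t : ℝ}

theorem zero (h : 𝒳.Small s t) : 𝒳.Small s 0 :=
  ⟨h.pos, h.le_one, by simp, by simp, by simpa using h.pos.le, h.gap⟩

/-- The perturbation is at most `½‖X_0 u‖ + s‖u‖`, and the gap bounds `s‖u‖` by `‖X_0 u‖ / 6`,
leaving a third of `‖X_0 u‖`. -/
theorem norm_X_zero_le_mul (h : 𝒳.Small s t) {u : (𝒳.X 0).domain} (hu : u ∈ 𝒳.domPerp) :
    ‖𝒳.X 0 u‖ ≤ 3 * ‖𝒳.map t u‖ := by
  have h1 := norm_map_sub_le h.abs_le u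
  have h2 := norm_sub_norm_le (𝒳.X 0 u) (𝒳.map t u)
  rw [norm_sub_rev] at h2
  have h3 := mul_le_mul_of_nonneg_right h.mul_C₀_le (norm_nonneg (𝒳.X 0 u))
  have h4 := mul_le_mul_of_nonneg_right h.mul_Xp_le (norm_nonneg (u : H))
  have h5 := h.gap u hu
  linarith

theorem eq_zero_of_map_eq_zero (h : 𝒳.Small s t) {u : (𝒳.X 0).domain} (hu : u ∈ 𝒳.domPerp)
    (hu0 : 𝒳.map t u = 0) : u = 0 := by
  have h1 := h.norm_X_zero_le_mul hu
  rw [hu0, norm_zero, mul_zero] at h1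
  have h2 := h.gap u hu
  have h3 := norm_nonneg (u : H)
  have h4 := h.pos
  have : ‖(u : H)‖ = 0 := by nlinarith
  exact Subtype.ext (norm_eq_zero.1 this)

theorem norm_map_le (h : 𝒳.Small s t) (u : (𝒳.X 0).domain) :
    ‖𝒳.map t u‖ ≤ 2 * (‖(u : H)‖ + ‖𝒳.X 0 u‖) := by
  have h1 := norm_map_sub_le h.abs_le u
  have h2 := norm_sub_norm_le (𝒳.map t u) (𝒳.X 0 u)
  have h3 := mul_le_mul_of_nonneg_right h.mul_C₀_le (norm_nonneg (𝒳.X 0 u))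
  have h4 := mul_le_mul_of_nonneg_right (h.mul_Xp_le.trans h.le_one) (norm_nonneg (u : H))
  linarith [norm_nonneg (u : H), norm_nonneg (𝒳.X 0 u)]

theorem isClosed_map_domPerp (h : 𝒳.Small s t) : IsClosed (𝒳.domPerp.map (𝒳.map t) : Set K) := by
  have hs := h.pos
  refine isClosed_map_of_isClosed_graph 𝒳.isClosed isClosed_N_orthogonal (𝒳.map t) (C := 2)
    (c := 3 * (1 + (6 * s)⁻¹)) h.norm_map_le fun u hu => ?_
  have h1 := h.norm_X_zero_le_mul (u := u) hu
  have h2 := h.gap u hu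
  have h3 : ‖(u : H)‖ ≤ (6 * s)⁻¹ * ‖𝒳.X 0 u‖ := by
    rw [inv_mul_eq_div, le_div_iff₀ (by positivity)]
    linarith
  calc _ ≤ (1 + (6 * s)⁻¹) * ‖𝒳.X 0 u‖ := by linarith
    _ ≤ (1 + (6 * s)⁻¹) * (3 * ‖𝒳.map t u‖) := by gcongr
    _ = _ := by ring

/-- The graph norms of `X(t)` and `X_0` are equivalent, so the graph of `X(t)`, the image of `Dom
X_0` under `u ↦ (u, X(t)u)`, is closed. -/
theorem isClosed_pencil (h : 𝒳.Small s t) : (pencil p 𝒳.X t).IsClosed := by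
  have h1 := isClosed_map_of_isClosed_graph 𝒳.isClosed (M := ⊤) isClosed_univ
    ((𝒳.X 0).domain.subtype.prod (𝒳.map t)) (C := 3) (c := 5) (fun u => ?_) (fun u _ => ?_)
  · have h2 : (pencil p 𝒳.X t).graph =
        (Submodule.comap (𝒳.X 0).domain.subtype ⊤).map
          ((𝒳.X 0).domain.subtype.prod (𝒳.map t)) := by
      ext ⟨x, y⟩
      rw [LinearPMap.mem_graph_iff]
      constructor
      · rintro ⟨⟨u, hu⟩, rfl, rfl⟩
        have hu' := 𝒳.domain_pencil t ▸ hu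
        exact ⟨⟨u, hu'⟩, trivial, Prod.ext rfl (pencil_apply t u hu hu').symm⟩
      · rintro ⟨⟨u, hu⟩, -, h3⟩
        have hu' : u ∈ (pencil p 𝒳.X t).domain := (𝒳.domain_pencil t).symm ▸ hu
        refine ⟨⟨u, hu'⟩, congrArg Prod.fst h3, ?_⟩
        rw [pencil_apply t u hu' hu]
        exact congrArg Prod.snd h3
    rw [LinearPMap.IsClosed, h2]
    exact h1
  · change max ‖(u : H)‖ ‖𝒳.map t u‖ ≤ _
    have := h.norm_map_le u
    exact max_le (by linarith [norm_nonneg (u : H), norm_nonneg (𝒳.X 0 u)])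
      (by linarith [norm_nonneg (u : H), norm_nonneg (𝒳.X 0 u)])
  · change _ ≤ 5 * max ‖(u : H)‖ ‖𝒳.map t u‖
    have h1 := norm_map_sub_le h.abs_le u
    have h2 := norm_sub_norm_le (𝒳.X 0 u) (𝒳.map t u)
    rw [norm_sub_rev] at h2
    have h3 := mul_le_mul_of_nonneg_right h.mul_C₀_le (norm_nonneg (𝒳.X 0 u))
    have h4 := mul_le_mul_of_nonneg_right (h.mul_Xp_le.trans h.le_one) (norm_nonneg (u : H))
    have h5 : ‖(u : H)‖ ≤ max ‖(u : H)‖ ‖𝒳.map t u‖ := le_max_left _ _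
    have h6 : ‖𝒳.map t u‖ ≤ max ‖(u : H)‖ ‖𝒳.map t u‖ := le_max_right _ _
    linarith

theorem dense_domain_pencil : Dense ((pencil p 𝒳.X t).domain : Set H) := by
  rw [𝒳.domain_pencil t]
  exact 𝒳.dense_domain

theorem isUnitaryGroupOf (h : 𝒳.Small s t) :
    IsUnitaryGroupOf (𝒳.A t) (unitaryExp (𝒳.A t)) :=
  isUnitaryGroupOf_unitaryExp dense_domain_pencil h.isClosed_pencil

end Small

theorem mem_A_iff {t : ℝ} {x y : H} : (∃ h : x ∈ (𝒳.A t).domain, 𝒳.A t ⟨x, h⟩ = y) ↔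
    ∃ h : x ∈ (𝒳.X 0).domain, ∀ v, ⟪𝒳.map t ⟨x, h⟩, 𝒳.map t v⟫_ℂ = ⟪y, (v : H)⟫_ℂ := by
  refine (mem_opComp_adjoint_self_iff Small.dense_domain_pencil).trans ?_
  have hd := 𝒳.domain_pencil t
  constructor
  · rintro ⟨h, hv⟩
    refine ⟨hd ▸ h, fun v => ?_⟩
    have hv' : (v : H) ∈ (pencil p 𝒳.X t).domain := hd.symm ▸ v.2
    rw [← pencil_apply (𝒳 := 𝒳) t x h, ← pencil_apply (𝒳 := 𝒳) t v hv' v.2]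
    exact hv ⟨v, hv'⟩
  · rintro ⟨h, hv⟩
    refine ⟨hd.symm ▸ h, fun v => ?_⟩
    have hv' : (v : H) ∈ (𝒳.X 0).domain := hd ▸ v.2
    rw [pencil_apply t x _ h, pencil_apply (𝒳 := 𝒳) t (v : H) v.2 hv']
    exact hv ⟨v, hv'⟩

end OperatorPencil

/-! ### The Schur complement -/

namespace OperatorPencil

variable {H : Type u} {K : Type v}
  [NormedAddCommGroup H] [InnerProductSpace ℂ H] [CompleteSpace H]
  [NormedAddCommGroup K] [InnerProductSpace ℂ K] [CompleteSpace K]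
  {p : ℕ} {𝒳 : OperatorPencil p H K} {s t : ℝ}

/-- `Y ω ∈ Dom X_0 ∩ 𝔑^⊥` is the correction for which `X(t) (ω + Y ω)` is orthogonal to
`X(t) (Dom X_0 ∩ 𝔑^⊥)`. -/
def IsCorrection (𝒳 : OperatorPencil p H K) (t : ℝ) (Y : 𝒳.N →ₗ[ℂ] (𝒳.X 0).domain) : Prop :=
  ∀ ω, Y ω ∈ 𝒳.domPerp ∧ ∀ ζ ∈ 𝒳.domPerp, ⟪𝒳.map t (𝒳.inclN ω + Y ω), 𝒳.map t ζ⟫_ℂ = 0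

/-- The corrector is the weak solution at `t = 0` with source `X_p ω`, so the default value in
`corrector` is not taken. -/
theorem Small.isCorrector_corrector (h : 𝒳.Small s t) : 𝒳.IsCorrector 𝒳.corrector := by
  have hex : ∃ ψ, 𝒳.IsCorrector ψ := by
    obtain ⟨ψ, hψ⟩ := exists_weak_solution (𝒳.map 0) 𝒳.domPerp h.zero.isClosed_map_domPerp
      (fun u hu hu0 => h.zero.eq_zero_of_map_eq_zero hu hu0)
      ((𝒳.Xp : H →ₗ[ℂ] K) ∘ₗ 𝒳.N.subtype)
    refine ⟨ψ, fun ω => ⟨(hψ ω).1, fun ζ hζ => ?_⟩⟩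
    have h1 := (hψ ω).2 ζ hζ
    rw [map_zero_eq, map_zero_eq, inner_add_left] at h1
    rw [inner_neg_left]
    exact eq_neg_of_add_eq_zero_left h1
  rw [corrector, dif_pos hex]
  exact hex.choose_spec

theorem Small.exists_isCorrection (h : 𝒳.Small s t) : ∃ Y, IsCorrection 𝒳 t Y := by
  obtain ⟨Y, hY⟩ := exists_weak_solution (𝒳.map t) 𝒳.domPerp h.isClosed_map_domPerp
    (fun u hu hu0 => h.eq_zero_of_map_eq_zero hu hu0) (𝒳.map t ∘ₗ 𝒳.inclN)
  refine ⟨Y, fun ω => ⟨(hY ω).1, fun ζ hζ => ?_⟩⟩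
  rw [add_comm, map_add]
  exact (hY ω).2 ζ hζ

/-- Pythagoras for `b = (a + b) + (-a)`. -/
theorem norm_le_of_inner_add_eq_zero {E : Type*} [NormedAddCommGroup E] [InnerProductSpace ℂ E]
    {a b : E} (h : ⟪a + b, a⟫_ℂ = 0) : ‖a‖ ≤ ‖b‖ ∧ ‖a + b‖ ≤ ‖b‖ := by
  have h1 : ⟪a + b, -a⟫_ℂ = 0 := by rw [inner_neg_right, h, neg_zero]
  have h2 := norm_add_sq_eq_norm_sq_add_norm_sq_of_inner_eq_zero _ _ h1
  rw [add_neg_cancel_comm, norm_neg] at h2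
  constructor <;>
  · refine abs_le_of_sq_le_sq' ?_ (norm_nonneg _) |>.2
    nlinarith [norm_nonneg a, norm_nonneg (a + b)]

namespace IsCorrection

variable {Y : 𝒳.N →ₗ[ℂ] (𝒳.X 0).domain}

theorem norm_map_apply_le (hY : IsCorrection 𝒳 t Y) (ω : 𝒳.N) :
    ‖𝒳.map t (Y ω)‖ ≤ |t| ^ p * (‖𝒳.Xp‖ * ‖ω‖) := by
  have h1 := (hY ω).2 _ (hY ω).1
  rw [add_comm, map_add] at h1
  refine (norm_le_of_inner_add_eq_zero h1).1.trans ?_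
  rw [map_inclN, norm_smul, norm_pow, Complex.norm_real, Real.norm_eq_abs]
  gcongr
  exact 𝒳.Xp.le_opNorm _

theorem norm_apply_le (hY : IsCorrection 𝒳 t Y) (h : 𝒳.Small s t) (ω : 𝒳.N) :
    ‖(Y ω : H)‖ ≤ |t| ^ p * (‖𝒳.Xp‖ / s / 2 * ‖ω‖) := by
  have h1 := hY.norm_map_apply_le ω
  have h2 := h.norm_X_zero_le_mul (hY ω).1
  have h3 := h.gap _ (hY ω).1
  have hs := h.pos
  -- The lower bound `3` for `X(t)` and the gap `6s` combine to the factor `1 / (2s)`.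
  have h4 : s * ‖(Y ω : H)‖ ≤ |t| ^ p * (‖𝒳.Xp‖ * ‖ω‖) / 2 := by linarith
  rw [← le_div_iff₀' hs] at h4
  refine h4.trans (le_of_eq ?_)
  field_simp

/-- The linear map `ω ↦ X(t) (ω + Y ω)`. -/
noncomputable def form (_ : IsCorrection 𝒳 t Y) : 𝒳.N →L[ℂ] K :=
  LinearMap.toContinuousLinearMap (𝒳.map t ∘ₗ (𝒳.inclN + Y))

theorem form_apply (hY : IsCorrection 𝒳 t Y) (ω : 𝒳.N) :
    hY.form ω = 𝒳.map t (𝒳.inclN ω + Y ω) := rfl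

/-- The Schur complement of `A(t)` on `𝔑`. -/
noncomputable def schur (hY : IsCorrection 𝒳 t Y) : 𝒳.N →L[ℂ] 𝒳.N :=
  ContinuousLinearMap.adjoint hY.form ∘L hY.form

/-- Write `v = (Pv + Y Pv) + ζ` with `ζ ∈ Dom X_0 ∩ 𝔑^⊥`. The part `ζ` drops out by the choice of
`Y`, so only `Pv` is seen. -/
theorem inner_form_map (hY : IsCorrection 𝒳 t Y) (ω : 𝒳.N) (v : (𝒳.X 0).domain) :
    ⟪hY.form ω, 𝒳.map t v⟫_ℂ = ⟪(hY.schur ω : H), (v : H)⟫_ℂ := by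
  rw [← inner_toN, schur, ContinuousLinearMap.comp_apply, ContinuousLinearMap.adjoint_inner_left,
    ← sub_eq_zero, ← inner_sub_right, form_apply hY (𝒳.toN v), ← map_sub, sub_add_eq_sub_sub]
  exact (hY ω).2 _ (𝒳.domPerp.sub_mem (sub_inclN_mem_domPerp v) (hY _).1)

/-- The value lies in `𝔑` rather than in the range of `1 + Y`; this mismatch produces the term with
`Y S` in the residual of `Small.norm_J_le`. -/
theorem A_apply (hY : IsCorrection 𝒳 t Y) (ω : 𝒳.N) :
    ∃ h : (ω : H) + Y ω ∈ (𝒳.A t).domain, 𝒳.A t ⟨(ω : H) + Y ω, h⟩ = hY.schur ω :=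
  mem_A_iff.2 ⟨(𝒳.inclN ω + Y ω).2, hY.inner_form_map ω⟩

end IsCorrection

/-! ### Asymptotics of the Schur complement -/

namespace Small

theorem norm_coe_le (h : 𝒳.Small s t) {u : (𝒳.X 0).domain} (hu : u ∈ 𝒳.domPerp) :
    ‖𝒳.Xp‖ * ‖(u : H)‖ ≤ ‖𝒳.Xp‖ / s * ‖𝒳.X 0 u‖ := by
  have hs := h.pos
  have h1 := h.gap u hu
  rw [div_mul_eq_mul_div, le_div_iff₀ hs, mul_assoc]
  gcongr
  nlinarith [norm_nonneg (u : H)]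

theorem norm_map_sub_le_mul (h : 𝒳.Small s t) {u : (𝒳.X 0).domain} (hu : u ∈ 𝒳.domPerp) :
    ‖𝒳.map t u - 𝒳.X 0 u‖ ≤ |t| * ((p * 𝒳.C₀ + ‖𝒳.Xp‖ / s) * ‖𝒳.X 0 u‖) := by
  refine (norm_map_sub_le h.abs_le u).trans ?_
  have h1 := mul_le_mul_of_nonneg_left (h.norm_coe_le hu) (abs_nonneg t)
  have h2 : 0 ≤ |t| * (𝒳.C₀ * ‖𝒳.X 0 u‖) :=
    mul_nonneg (abs_nonneg _) (mul_nonneg (zero_le_one.trans 𝒳.one_le_C₀) (norm_nonneg _))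
  nlinarith

theorem norm_map_sub_sub_le_mul (h : 𝒳.Small s t) {u : (𝒳.X 0).domain} (hu : u ∈ 𝒳.domPerp) :
    ‖𝒳.map t u - 𝒳.X 0 u - (t : ℂ) • 𝒳.coeff 1 u‖ ≤
      t ^ 2 * ((p * 𝒳.C₀ + ‖𝒳.Xp‖ / s) * ‖𝒳.X 0 u‖) := by
  refine (norm_map_sub_sub_le h.abs_le u).trans ?_
  have h1 := h.norm_coe_le hu
  gcongr
  linarith

theorem R_apply (ω : 𝒳.N) : 𝒳.R ω = 𝒳.X 0 (𝒳.corrector ω) + 𝒳.Xp ω := rfl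

theorem inner_R (h : 𝒳.Small s t) (ω : 𝒳.N) {ζ : (𝒳.X 0).domain} (hζ : ζ ∈ 𝒳.domPerp) :
    ⟪𝒳.R ω, 𝒳.X 0 ζ⟫_ℂ = 0 := by
  rw [R_apply, inner_add_left, (h.isCorrector_corrector ω).2 ζ hζ, inner_neg_left, neg_add_cancel]

theorem corrector_mem (h : 𝒳.Small s t) (ω : 𝒳.N) : 𝒳.corrector ω ∈ 𝒳.domPerp :=
  (h.isCorrector_corrector ω).1

theorem norm_X_corrector_le (h : 𝒳.Small s t) (ω : 𝒳.N) :
    ‖𝒳.X 0 (𝒳.corrector ω)‖ ≤ ‖𝒳.Xp‖ * ‖ω‖ :=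
  (norm_le_of_inner_add_eq_zero (h.inner_R ω (h.corrector_mem ω))).1.trans (𝒳.Xp.le_opNorm _)

theorem norm_R_apply_le (h : 𝒳.Small s t) (ω : 𝒳.N) : ‖𝒳.R ω‖ ≤ ‖𝒳.Xp‖ * ‖ω‖ :=
  (norm_le_of_inner_add_eq_zero (h.inner_R ω (h.corrector_mem ω))).2.trans (𝒳.Xp.le_opNorm _)

theorem norm_S_le (h : 𝒳.Small s t) : ‖𝒳.S‖ ≤ ‖𝒳.Xp‖ ^ 2 := by
  have h1 : ‖𝒳.R‖ ≤ ‖𝒳.Xp‖ := 𝒳.R.opNorm_le_bound (norm_nonneg _) h.norm_R_apply_le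
  refine (ContinuousLinearMap.opNorm_comp_le _ _).trans ?_
  rw [LinearIsometryEquiv.norm_map, sq]
  exact mul_le_mul h1 h1 (norm_nonneg _) (norm_nonneg _)

theorem norm_X₁_corrector_le (h : 𝒳.Small s t) (ω : 𝒳.N) :
    ‖𝒳.coeff 1 (𝒳.corrector ω)‖ ≤ 𝒳.C₀ * (‖𝒳.Xp‖ * ‖ω‖) := by
  refine (norm_coeff_le 𝒳.two_le _).trans ?_
  have := 𝒳.one_le_C₀
  gcongr
  exact h.norm_X_corrector_le ω

/-- The sesquilinear form of `G` on `𝔑`, which is the coefficient of `t^{2p+1}` in the Schur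
complement. -/
theorem inner_add_inner_eq_zero (hG : 𝒳.G = 0) (ω ω' : 𝒳.N) :
    ⟪𝒳.R ω, 𝒳.coeff 1 (𝒳.corrector ω')⟫_ℂ + ⟪𝒳.coeff 1 (𝒳.corrector ω), 𝒳.R ω'⟫_ℂ = 0 := by
  have h1 : ⟪𝒳.G ω, (ω' : H)⟫_ℂ = 0 := by rw [hG]; exact inner_zero_left _
  have hR : ∀ ν : 𝒳.N, 𝒳.RP ν = 𝒳.R ν := fun ν => congrArg 𝒳.R (toN_coe ν)
  have hX : ∀ ν : 𝒳.N, 𝒳.X₁Z ν = 𝒳.coeff 1 (𝒳.corrector ν) := fun ν => by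
    rw [coeff_apply (one_le_two.trans 𝒳.two_le)]
    change 𝒳.X 1 ⟨𝒳.corrector (𝒳.toN ν), _⟩ = _
    congr 3
    rw [toN_coe]
  rw [G, add_apply, ContinuousLinearMap.comp_apply, ContinuousLinearMap.comp_apply,
    inner_add_left, ContinuousLinearMap.adjoint_inner_left, ContinuousLinearMap.adjoint_inner_left,
    hR, hR, hX, hX] at h1
  linear_combination h1

/-- The first approximation `ω + t^p Z ω` to `ω + Y ω`. -/
theorem map_inclN_add_corrector (t : ℝ) (ω : 𝒳.N) :
    𝒳.map t (𝒳.inclN ω + ((t : ℂ) ^ p) • 𝒳.corrector ω) = ((t : ℂ) ^ p) •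
      (𝒳.R ω + (t : ℂ) • 𝒳.coeff 1 (𝒳.corrector ω) + (𝒳.map t (𝒳.corrector ω) -
        𝒳.X 0 (𝒳.corrector ω) - (t : ℂ) • 𝒳.coeff 1 (𝒳.corrector ω))) := by
  rw [map_add, map_smul, map_inclN, R_apply, ← smul_add]
  congr 1
  abel

end Small

/-- The constant `p C_0 + ‖X_p‖ / s` that enters the estimates of the Schur complement. -/
noncomputable def schurConst (𝒳 : OperatorPencil p H K) (s : ℝ) : ℝ := p * 𝒳.C₀ + ‖𝒳.Xp‖ / s

theorem Small.C₀_le_schurConst (h : 𝒳.Small s t) : 𝒳.C₀ ≤ 𝒳.schurConst s := by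
  have hs := h.pos
  have h1 : (1 : ℝ) ≤ p := by exact_mod_cast one_le_two.trans 𝒳.two_le
  have h2 : 0 ≤ ‖𝒳.Xp‖ / s := by positivity
  have := 𝒳.one_le_C₀
  rw [schurConst]
  nlinarith

theorem Small.norm_remainder_le (h : 𝒳.Small s t) (ω : 𝒳.N) :
    ‖𝒳.map t (𝒳.corrector ω) - 𝒳.X 0 (𝒳.corrector ω) - (t : ℂ) • 𝒳.coeff 1 (𝒳.corrector ω)‖ ≤
      t ^ 2 * (𝒳.schurConst s * (‖𝒳.Xp‖ * ‖ω‖)) := by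
  refine (h.norm_map_sub_sub_le_mul (h.corrector_mem ω)).trans ?_
  have hk := 𝒳.one_le_C₀.trans h.C₀_le_schurConst
  rw [← schurConst]
  gcongr
  exact h.norm_X_corrector_le ω

namespace IsCorrection

variable {Y : 𝒳.N →ₗ[ℂ] (𝒳.X 0).domain}

/-- For `r = Yω - t^p Zω`, orthogonality gives `‖X(t)r‖² = -⟪X(t)(ω + t^p Zω), X(t)r⟫`. The leading
vector `Rω` is orthogonal to `X_0 r`, so it meets only `(X(t) - X_0) r`, which gains a factor `|t|`.
The constant is `5 = 3 + 1 + 1`, from `Rω`, `t X_1 Zω` and the remainder. -/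
theorem norm_map_sub_corrector_le (hY : IsCorrection 𝒳 t Y) (h : 𝒳.Small s t) (ω : 𝒳.N) :
    ‖𝒳.map t (Y ω - ((t : ℂ) ^ p) • 𝒳.corrector ω)‖ ≤
      |t| ^ (p + 1) * (5 * 𝒳.schurConst s * (‖𝒳.Xp‖ * ‖ω‖)) := by
  have hC := h.C₀_le_schurConst
  have hk := 𝒳.one_le_C₀.trans hC
  have hr : Y ω - ((t : ℂ) ^ p) • 𝒳.corrector ω ∈ 𝒳.domPerp :=
    𝒳.domPerp.sub_mem (hY ω).1 (𝒳.domPerp.smul_mem _ (h.corrector_mem ω))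
  set r := Y ω - ((t : ℂ) ^ p) • 𝒳.corrector ω with hr_def
  set n := ‖𝒳.Xp‖ * ‖ω‖ with hn
  have hn0 : 0 ≤ n := by positivity
  have h1 : ⟪𝒳.map t r, 𝒳.map t r⟫_ℂ =
      -⟪𝒳.map t (𝒳.inclN ω + ((t : ℂ) ^ p) • 𝒳.corrector ω), 𝒳.map t r⟫_ℂ := by
    rw [eq_neg_iff_add_eq_zero, ← inner_add_left, ← map_add, ← (hY ω).2 r hr]
    congr 2
    rw [hr_def]
    abel
  rw [Small.map_inclN_add_corrector, inner_smul_left] at h1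
  have h2 : ⟪𝒳.R ω, 𝒳.map t r⟫_ℂ = ⟪𝒳.R ω, 𝒳.map t r - 𝒳.X 0 r⟫_ℂ := by
    rw [inner_sub_right, h.inner_R ω hr, sub_zero]
  have h3 : ‖⟪𝒳.R ω, 𝒳.map t r⟫_ℂ‖ ≤ |t| * (3 * 𝒳.schurConst s * n) * ‖𝒳.map t r‖ := by
    rw [h2]
    refine (norm_inner_le_norm _ _).trans ?_
    have h4 := h.norm_map_sub_le_mul hr
    rw [← schurConst] at h4
    have h5 := h.norm_X_zero_le_mul hr
    calc _ ≤ n * (|t| * (𝒳.schurConst s * (3 * ‖𝒳.map t r‖))) := by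
          refine mul_le_mul (h.norm_R_apply_le ω) (h4.trans ?_) (norm_nonneg _) hn0
          gcongr
      _ = _ := by ring
  have h6 : ‖⟪(t : ℂ) • 𝒳.coeff 1 (𝒳.corrector ω), 𝒳.map t r⟫_ℂ‖ ≤
      |t| * (𝒳.schurConst s * n) * ‖𝒳.map t r‖ := by
    refine (norm_inner_le_norm _ _).trans ?_
    rw [norm_smul, Complex.norm_real, Real.norm_eq_abs]
    gcongr
    exact (h.norm_X₁_corrector_le ω).trans (by gcongr)
  have h7 : ‖⟪𝒳.map t (𝒳.corrector ω) - 𝒳.X 0 (𝒳.corrector ω) -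
      (t : ℂ) • 𝒳.coeff 1 (𝒳.corrector ω), 𝒳.map t r⟫_ℂ‖ ≤
      |t| * (𝒳.schurConst s * n) * ‖𝒳.map t r‖ := by
    refine (norm_inner_le_norm _ _).trans ?_
    gcongr
    refine (h.norm_remainder_le ω).trans ?_
    rw [← sq_abs]
    gcongr
    exact pow_le_of_le_one (abs_nonneg _) h.abs_le two_ne_zero
  have h8 : ‖𝒳.map t r‖ ^ 2 ≤ |t| ^ p * (|t| * (5 * 𝒳.schurConst s * n) * ‖𝒳.map t r‖) := by
    have h9 := congrArg norm h1
    rw [inner_self_eq_norm_sq_to_K, norm_pow, RCLike.norm_ofReal, abs_norm, norm_neg, norm_mul,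
      RCLike.norm_conj, norm_pow, Complex.norm_real, Real.norm_eq_abs, inner_add_left,
      inner_add_left] at h9
    rw [h9]
    gcongr
    refine (norm_add_le _ _).trans ((add_le_add (norm_add_le _ _) le_rfl).trans ?_)
    linarith
  rcases (norm_nonneg (𝒳.map t r)).eq_or_lt with h10 | h10
  · rw [← h10]
    positivity
  · rw [pow_succ]
    nlinarith

/-- Galerkin orthogonality: the cross terms with `Y - η` vanish, so the error of a trial correction
`η` enters quadratically. -/
theorem inner_schur_eq (hY : IsCorrection 𝒳 t Y) {η : 𝒳.N →ₗ[ℂ] (𝒳.X 0).domain}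
    (hη : ∀ ω, η ω ∈ 𝒳.domPerp) (ω ω' : 𝒳.N) :
    ⟪hY.schur ω, ω'⟫_ℂ = ⟪𝒳.map t (𝒳.inclN ω + η ω), 𝒳.map t (𝒳.inclN ω' + η ω')⟫_ℂ -
      ⟪𝒳.map t (Y ω - η ω), 𝒳.map t (Y ω' - η ω')⟫_ℂ := by
  have hm : ∀ ν, Y ν - η ν ∈ 𝒳.domPerp := fun ν => 𝒳.domPerp.sub_mem (hY ν).1 (hη ν)
  have h1 : ∀ ν, 𝒳.map t (𝒳.inclN ν + η ν) =
      𝒳.map t (𝒳.inclN ν + Y ν) - 𝒳.map t (Y ν - η ν) := fun ν => by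
    rw [← map_sub]
    congr 1
    abel
  have h2 := (hY ω).2 _ (hm ω')
  have h3 : ⟪𝒳.map t (Y ω - η ω), 𝒳.map t (𝒳.inclN ω' + Y ω')⟫_ℂ = 0 := by
    rw [← inner_conj_symm, (hY ω').2 _ (hm ω), map_zero]
  rw [schur, ContinuousLinearMap.comp_apply, ContinuousLinearMap.adjoint_inner_left, form_apply,
    form_apply, h1 ω, h1 ω']
  simp only [inner_sub_left, inner_sub_right] at h2 h3 ⊢
  linear_combination h2 + h3

omit [CompleteSpace K] in
theorem _root_.norm_inner_expansion_le {t k n n' : ℝ} {a a' x x' q q' r r' : K} (ht : |t| ≤ 1)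
    (hk : 1 ≤ k) (hn : 0 ≤ n) (hn' : 0 ≤ n') (ha : ‖a‖ ≤ n) (ha' : ‖a'‖ ≤ n')
    (hx : ‖x‖ ≤ k * n) (hx' : ‖x'‖ ≤ k * n') (hq : ‖q‖ ≤ t ^ 2 * (k * n))
    (hq' : ‖q'‖ ≤ t ^ 2 * (k * n')) (hr : ‖r‖ ≤ |t| ^ (p + 1) * (5 * k * n))
    (hr' : ‖r'‖ ≤ |t| ^ (p + 1) * (5 * k * n')) (hg : ⟪a, x'⟫_ℂ + ⟪x, a'⟫_ℂ = 0) :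
    ‖⟪((t : ℂ) ^ p) • (a + (t : ℂ) • x + q), ((t : ℂ) ^ p) • (a' + (t : ℂ) • x' + q')⟫_ℂ -
      ⟪r, r'⟫_ℂ - (t : ℂ) ^ (2 * p) * ⟪a, a'⟫_ℂ‖ ≤ |t| ^ (2 * p + 2) * (31 * k ^ 2 * (n * n')) := by
  have hkn : n ≤ k * n := le_mul_of_one_le_left hn hk
  have hkn' : n' ≤ k * n' := le_mul_of_one_le_left hn' hk
  have hb : ∀ {b y : K} {m : ℝ}, 0 ≤ m → ‖b‖ ≤ m → ‖y‖ ≤ m → ‖b + (t : ℂ) • y‖ ≤ 2 * m := by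
    intro b y m hm hb hy
    refine (norm_add_le _ _).trans ?_
    rw [norm_smul, Complex.norm_real, Real.norm_eq_abs]
    have := mul_le_mul ht hy (norm_nonneg _) zero_le_one
    linarith
  have hb1 := hb (hn.trans hkn) (ha.trans hkn) hx
  have hb2 := hb (hn'.trans hkn') (ha'.trans hkn') hx'
  have h1 : ⟪((t : ℂ) ^ p) • (a + (t : ℂ) • x + q), ((t : ℂ) ^ p) • (a' + (t : ℂ) • x' + q')⟫_ℂ -
      ⟪r, r'⟫_ℂ - (t : ℂ) ^ (2 * p) * ⟪a, a'⟫_ℂ = (t : ℂ) ^ (2 * p) * ((t : ℂ) ^ 2 * ⟪x, x'⟫_ℂ +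
        ⟪a + (t : ℂ) • x, q'⟫_ℂ + ⟪q, a' + (t : ℂ) • x'⟫_ℂ + ⟪q, q'⟫_ℂ) - ⟪r, r'⟫_ℂ := by
    simp only [inner_smul_left, inner_smul_right, inner_add_left, inner_add_right, map_pow,
      Complex.conj_ofReal]
    linear_combination (t : ℂ) ^ (2 * p) * (t : ℂ) * hg
  -- The vanishing of the order `t^{2p+1}` has been used; the four remaining products contribute `1
  -- + 2 + 2 + 1 = 6`, and `⟪r, r'⟫` adds `25` to give `31`.
  have hN : ‖(t : ℂ) ^ 2 * ⟪x, x'⟫_ℂ + ⟪a + (t : ℂ) • x, q'⟫_ℂ + ⟪q, a' + (t : ℂ) • x'⟫_ℂ +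
      ⟪q, q'⟫_ℂ‖ ≤ |t| ^ 2 * (6 * ((k * n) * (k * n'))) := by
    have e1 : ‖(t : ℂ) ^ 2 * ⟪x, x'⟫_ℂ‖ ≤ |t| ^ 2 * ((k * n) * (k * n')) := by
      rw [norm_mul, norm_pow, Complex.norm_real, Real.norm_eq_abs]
      gcongr
      exact (norm_inner_le_norm _ _).trans (mul_le_mul hx hx' (norm_nonneg _) (by positivity))
    have e2 := (norm_inner_le_norm (𝕜 := ℂ) (a + (t : ℂ) • x) q').trans
      (mul_le_mul hb1 hq' (norm_nonneg _) (by positivity))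
    have e3 := (norm_inner_le_norm (𝕜 := ℂ) q (a' + (t : ℂ) • x')).trans
      (mul_le_mul hq hb2 (norm_nonneg _) (by positivity))
    have hq1 : ‖q‖ ≤ k * n := hq.trans (mul_le_of_le_one_left (by positivity)
      ((sq_le_one_iff_abs_le_one t).2 ht))
    have e4 := (norm_inner_le_norm (𝕜 := ℂ) q q').trans
      (mul_le_mul hq1 hq' (norm_nonneg _) (by positivity))
    refine (norm_add_le _ _).trans ((add_le_add (norm_add_le _ _) le_rfl).trans
      ((add_le_add (add_le_add (norm_add_le _ _) le_rfl) le_rfl).trans ?_))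
    rw [sq_abs] at *
    linarith
  have hr2 := (norm_inner_le_norm (𝕜 := ℂ) r r').trans
    (mul_le_mul hr hr' (norm_nonneg _) (by positivity))
  rw [h1]
  refine (norm_sub_le _ _).trans ?_
  rw [norm_mul, norm_pow, Complex.norm_real, Real.norm_eq_abs]
  calc _ ≤ |t| ^ (2 * p) * (|t| ^ 2 * (6 * ((k * n) * (k * n')))) +
        |t| ^ (p + 1) * (5 * k * n) * (|t| ^ (p + 1) * (5 * k * n')) := by gcongr
    _ = _ := by ring

theorem norm_inner_schur_sub_le (hY : IsCorrection 𝒳 t Y) (h : 𝒳.Small s t) (hG : 𝒳.G = 0)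
    (ω ω' : 𝒳.N) :
    ‖⟪hY.schur ω, ω'⟫_ℂ - (t : ℂ) ^ (2 * p) * ⟪𝒳.S ω, ω'⟫_ℂ‖ ≤
      |t| ^ (2 * p + 2) * (31 * (𝒳.schurConst s * ‖𝒳.Xp‖) ^ 2 * (‖ω‖ * ‖ω'‖)) := by
  have hC := h.C₀_le_schurConst
  have hC1 := 𝒳.one_le_C₀
  set k := 𝒳.schurConst s with hk_def
  have hk : 1 ≤ k := hC1.trans hC
  have h1 := hY.inner_schur_eq (η := ((t : ℂ) ^ p) • 𝒳.corrector)
    (fun ν => 𝒳.domPerp.smul_mem _ (h.corrector_mem ν)) ω ω'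
  have hS : ⟪𝒳.S ω, ω'⟫_ℂ = ⟪𝒳.R ω, 𝒳.R ω'⟫_ℂ := by
    rw [S, ContinuousLinearMap.comp_apply, ContinuousLinearMap.adjoint_inner_left]
  have hg := Small.inner_add_inner_eq_zero hG ω ω'
  have hr := hY.norm_map_sub_corrector_le h ω
  have hr' := hY.norm_map_sub_corrector_le h ω'
  have hR := h.norm_R_apply_le ω
  have hR' := h.norm_R_apply_le ω'
  have hX := h.norm_X₁_corrector_le ω
  have hX' := h.norm_X₁_corrector_le ω'
  have hq := h.norm_remainder_le ω
  have hq' := h.norm_remainder_le ω'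
  rw [← hk_def] at hr hr' hq hq'
  simp only [LinearMap.smul_apply] at h1
  rw [Small.map_inclN_add_corrector, Small.map_inclN_add_corrector] at h1
  rw [h1, hS]
  clear h1 hS
  generalize 𝒳.map t (𝒳.corrector ω) - 𝒳.X 0 (𝒳.corrector ω) -
    (t : ℂ) • 𝒳.coeff 1 (𝒳.corrector ω) = q at *
  generalize 𝒳.map t (𝒳.corrector ω') - 𝒳.X 0 (𝒳.corrector ω') -
    (t : ℂ) • 𝒳.coeff 1 (𝒳.corrector ω') = q' at *
  generalize 𝒳.map t (Y ω - ((t : ℂ) ^ p) • 𝒳.corrector ω) = r at *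
  generalize 𝒳.map t (Y ω' - ((t : ℂ) ^ p) • 𝒳.corrector ω') = r' at *
  generalize 𝒳.coeff 1 (𝒳.corrector ω) = x at *
  generalize 𝒳.coeff 1 (𝒳.corrector ω') = x' at *
  generalize 𝒳.R ω = a at *
  generalize 𝒳.R ω' = a' at *
  have hn0 : 0 ≤ ‖𝒳.Xp‖ * ‖ω‖ := by positivity
  have hn0' : 0 ≤ ‖𝒳.Xp‖ * ‖ω'‖ := by positivity
  refine (norm_inner_expansion_le h.abs_le hk hn0 hn0' hR hR' (hX.trans (by gcongr))
    (hX'.trans (by gcongr)) hq hq' hr hr' hg).trans (le_of_eq ?_)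
  ring

end IsCorrection

end OperatorPencil

/-! ### The estimate of `J` -/

namespace OperatorPencil

variable {H : Type u} {K : Type v}
  [NormedAddCommGroup H] [InnerProductSpace ℂ H] [CompleteSpace H]
  [NormedAddCommGroup K] [InnerProductSpace ℂ K] [CompleteSpace K]
  {p : ℕ} {𝒳 : OperatorPencil p H K} {s t : ℝ}

theorem IsCorrection.norm_schur_sub_le {Y : 𝒳.N →ₗ[ℂ] (𝒳.X 0).domain} (hY : IsCorrection 𝒳 t Y)
    (h : 𝒳.Small s t) (hG : 𝒳.G = 0) (ω : 𝒳.N) :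
    ‖hY.schur ω - (t : ℂ) ^ (2 * p) • 𝒳.S ω‖ ≤
      |t| ^ (2 * p + 2) * (31 * (𝒳.schurConst s * ‖𝒳.Xp‖) ^ 2) * ‖ω‖ := by
  set ν := hY.schur ω - (t : ℂ) ^ (2 * p) • 𝒳.S ω with hν
  have h1 := hY.norm_inner_schur_sub_le h hG ω ν
  have h2 : ⟪hY.schur ω, ν⟫_ℂ - (t : ℂ) ^ (2 * p) * ⟪𝒳.S ω, ν⟫_ℂ = ⟪ν, ν⟫_ℂ := by
    conv_rhs => rw [hν]
    rw [inner_sub_left, inner_smul_left, map_pow, Complex.conj_ofReal]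
  rw [h2, inner_self_eq_norm_sq_to_K, norm_pow, RCLike.norm_ofReal, abs_norm] at h1
  rcases (norm_nonneg ν).eq_or_lt with h10 | h10
  · rw [← h10]
    positivity
  · nlinarith

theorem isSelfAdjoint_SP : IsSelfAdjoint 𝒳.SP := by
  rw [ContinuousLinearMap.isSelfAdjoint_iff_isSymmetric]
  intro x y
  change ⟪(𝒳.S (𝒳.toN x) : H), y⟫_ℂ = ⟪x, (𝒳.S (𝒳.toN y) : H)⟫_ℂ
  have h1 : ∀ (ω : 𝒳.N) (z : H), ⟪z, (ω : H)⟫_ℂ = ⟪𝒳.toN z, ω⟫_ℂ := fun ω z => by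
    rw [← inner_conj_symm, ← inner_toN, inner_conj_symm]
  rw [← inner_toN, h1, S, ContinuousLinearMap.comp_apply, ContinuousLinearMap.comp_apply,
    ContinuousLinearMap.adjoint_inner_left, ContinuousLinearMap.adjoint_inner_right]

theorem P_mul_SP : 𝒳.P * 𝒳.SP = 𝒳.SP := by
  ext x
  change ((𝒳.toN (𝒳.S (𝒳.toN x) : H) : 𝒳.N) : H) = 𝒳.S (𝒳.toN x)
  rw [toN_coe]

theorem SP_mul_P : 𝒳.SP * 𝒳.P = 𝒳.SP := by
  ext x
  change ((𝒳.S (𝒳.toN (𝒳.toN x : H))) : H) = 𝒳.S (𝒳.toN x)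
  rw [toN_coe]

variable (𝒳 t) in
/-- The unitary group `exp (-iτ t^{2p} SP)`. -/
noncomputable def germExp (τ : ℝ) : H →L[ℂ] H :=
  NormedSpace.exp ((-(Complex.I * (τ : ℂ) * (t : ℂ) ^ (2 * p))) • 𝒳.SP)

theorem germExp_zero : 𝒳.germExp t 0 = 1 := by simp [germExp]

theorem hasDerivAt_germExp (τ : ℝ) : HasDerivAt (𝒳.germExp t)
    (-(Complex.I * (t : ℂ) ^ (2 * p)) • (𝒳.SP * 𝒳.germExp t τ)) τ := by
  have h1 : ∀ τ : ℝ, (-(Complex.I * (τ : ℂ) * (t : ℂ) ^ (2 * p))) • 𝒳.SP =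
      τ • ((-(Complex.I * (t : ℂ) ^ (2 * p))) • 𝒳.SP) := fun τ => by
    rw [← Complex.coe_smul, smul_smul]
    congr 1
    ring
  have h2 : 𝒳.germExp t =
      fun τ : ℝ => NormedSpace.exp (τ • ((-(Complex.I * (t : ℂ) ^ (2 * p))) • 𝒳.SP)) :=
    funext fun τ => by rw [germExp, h1]
  have h3 := hasDerivAt_exp_smul_const' (𝕂 := ℝ) ((-(Complex.I * (t : ℂ) ^ (2 * p))) • 𝒳.SP) τ
  rw [h2]
  simpa only [smul_mul_assoc] using h3

theorem germExp_mem_unitary (τ : ℝ) : 𝒳.germExp t τ ∈ unitary (H →L[ℂ] H) := by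
  let _ : NormedAlgebra ℚ (H →L[ℂ] H) := .restrictScalars ℚ ℂ _
  refine NormedSpace.exp_mem_unitary_of_mem_skewAdjoint ?_
  rw [skewAdjoint.mem_iff, star_smul, isSelfAdjoint_SP.star_eq, ← neg_smul]
  congr 1
  simp

theorem norm_germExp_apply (τ : ℝ) (x : H) : ‖𝒳.germExp t τ x‖ = ‖x‖ :=
  (ContinuousLinearMap.norm_map_iff_adjoint_comp_self _).2
    (Unitary.mem_iff.1 (germExp_mem_unitary τ)).1 x

theorem P_germExp_apply (τ : ℝ) (x : H) : 𝒳.P (𝒳.germExp t τ x) = 𝒳.germExp t τ (𝒳.P x) := by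
  have h : Commute 𝒳.P 𝒳.SP := P_mul_SP.trans SP_mul_P.symm
  have h2 : Commute 𝒳.P (𝒳.germExp t τ) := (h.smul_right _).exp_right
  exact DFunLike.congr_fun h2.eq x

/-- The germ evolution lifted by `1 + Y` is compared with the exact one. The first term pays for
inserting `Y` at times `0` and `τ`, each costing half of it; the second is the residual integrated
over time. -/
theorem Small.norm_J_le (h : 𝒳.Small s t) (hG : 𝒳.G = 0) (τ : ℝ) :
    ‖𝒳.J t τ‖ ≤ |t| ^ p * (‖𝒳.Xp‖ / s) +
      |t| ^ (2 * p + 2) * (31 * (𝒳.schurConst s * ‖𝒳.Xp‖) ^ 2 +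
        ‖𝒳.Xp‖ / s / 2 * ‖𝒳.Xp‖ ^ 2) * |τ| := by
  obtain ⟨Y, hY⟩ := h.exists_isCorrection
  have hs := h.pos
  have hU := h.isUnitaryGroupOf
  refine ContinuousLinearMap.opNorm_le_bound _ (by positivity) fun x => ?_
  let W : 𝒳.N →L[ℂ] H :=
    LinearMap.toContinuousLinearMap ((𝒳.X 0).domain.subtype ∘ₗ (𝒳.inclN + Y))
  have hW : ∀ ω, W ω = (ω : H) + Y ω := fun ω => rfl
  have hYn : ∀ y : H, ‖y‖ = ‖x‖ → ‖(Y (𝒳.toN y) : H)‖ ≤ |t| ^ p * (‖𝒳.Xp‖ / s / 2 * ‖x‖) := by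
    intro y hy
    refine (hY.norm_apply_le h _).trans ?_
    gcongr
    exact (norm_toN_le y).trans_eq hy
  have hw : ∀ τ, HasDerivAt (fun τ => W (𝒳.toN (𝒳.germExp t τ x)))
      (W (𝒳.toN (-(Complex.I * (t : ℂ) ^ (2 * p)) • 𝒳.SP (𝒳.germExp t τ x)))) τ := by
    intro τ
    have h1 := (hasDerivAt_germExp (𝒳 := 𝒳) (t := t) τ)
    have h2 := ((W ∘L 𝒳.toN ∘L ContinuousLinearMap.apply ℂ H x).restrictScalars
      ℝ).hasFDerivAt.comp_hasDerivAt τ h1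
    exact h2
  have hm := fun τ => (hY.A_apply (𝒳.toN (𝒳.germExp t τ x))).1
  have hE : ∀ τ, ‖W (𝒳.toN (-(Complex.I * (t : ℂ) ^ (2 * p)) • 𝒳.SP (𝒳.germExp t τ x))) +
      Complex.I • 𝒳.A t ⟨W (𝒳.toN (𝒳.germExp t τ x)), hm τ⟩‖ ≤
      |t| ^ (2 * p + 2) * (31 * (𝒳.schurConst s * ‖𝒳.Xp‖) ^ 2 +
        ‖𝒳.Xp‖ / s / 2 * ‖𝒳.Xp‖ ^ 2) * ‖x‖ := by
    intro τ
    have hν : ‖𝒳.toN (𝒳.germExp t τ x)‖ ≤ ‖x‖ := (norm_toN_le _).trans_eq (norm_germExp_apply τ x)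
    have h1 : 𝒳.toN (𝒳.SP (𝒳.germExp t τ x)) = 𝒳.S (𝒳.toN (𝒳.germExp t τ x)) := toN_coe _
    have h2 : 𝒳.A t ⟨W (𝒳.toN (𝒳.germExp t τ x)), hm τ⟩ =
        hY.schur (𝒳.toN (𝒳.germExp t τ x)) := (hY.A_apply _).2
    rw [h2, map_smul, map_smul, h1]
    generalize 𝒳.toN (𝒳.germExp t τ x) = ν at hν
    have h3 := hY.norm_schur_sub_le h hG ν
    have h4 := hY.norm_apply_le h (𝒳.S ν)
    have h5 : ‖𝒳.S ν‖ ≤ ‖𝒳.Xp‖ ^ 2 * ‖ν‖ := 𝒳.S.le_of_opNorm_le h.norm_S_le ν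
    -- The residual splits into the error of the Schur complement and `t^{2p} Y S ν`. The latter is
    -- of order `|t|^{3p}`, which is at most `|t|^{2p+2}` because `p ≥ 2`.
    have h6 : -(Complex.I * (t : ℂ) ^ (2 * p)) • W (𝒳.S ν) + Complex.I • (hY.schur ν : H) =
        Complex.I • (((hY.schur ν - (t : ℂ) ^ (2 * p) • 𝒳.S ν : 𝒳.N) : H) -
          (t : ℂ) ^ (2 * p) • (Y (𝒳.S ν) : H)) := by
      rw [hW, AddSubgroupClass.coe_sub, Submodule.coe_smul]
      module
    rw [h6, norm_smul, Complex.norm_I, one_mul]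
    have h7 : ‖(t : ℂ) ^ (2 * p) • (Y (𝒳.S ν) : H)‖ ≤
        |t| ^ (2 * p + 2) * (‖𝒳.Xp‖ / s / 2 * ‖𝒳.Xp‖ ^ 2) * ‖ν‖ := by
      rw [norm_smul, norm_pow, Complex.norm_real, Real.norm_eq_abs]
      calc _ ≤ |t| ^ (2 * p) * (|t| ^ p * (‖𝒳.Xp‖ / s / 2 * (‖𝒳.Xp‖ ^ 2 * ‖ν‖))) := by
            gcongr
            exact h4.trans (by gcongr)
        _ ≤ |t| ^ (2 * p) * (|t| ^ 2 * (‖𝒳.Xp‖ / s / 2 * (‖𝒳.Xp‖ ^ 2 * ‖ν‖))) := by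
            refine mul_le_mul_of_nonneg_left (mul_le_mul_of_nonneg_right ?_ ?_) (by positivity)
            · exact pow_le_pow_of_le_one (abs_nonneg _) h.abs_le 𝒳.two_le
            · positivity
        _ = _ := by ring
    refine (norm_sub_le _ _).trans ((add_le_add h3 h7).trans ?_)
    rw [← add_mul, ← mul_add]
    gcongr
  have hmain := hU.norm_sub_apply_le hw hm hE τ
  have hJ : 𝒳.J t τ x = unitaryExp (𝒳.A t) τ (𝒳.P x) - 𝒳.germExp t τ (𝒳.P x) := rfl
  have hw1 : W (𝒳.toN (𝒳.germExp t τ x)) =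
      𝒳.germExp t τ (𝒳.P x) + Y (𝒳.toN (𝒳.germExp t τ x)) := by
    rw [hW, coe_toN, P_germExp_apply]
  have hw0 : W (𝒳.toN (𝒳.germExp t 0 x)) = 𝒳.P x + Y (𝒳.toN x) := by
    rw [germExp_zero, hW, one_apply_eq_self, coe_toN]
  rw [hw1, hw0, map_add] at hmain
  have hsum : 𝒳.J t τ x = (Y (𝒳.toN (𝒳.germExp t τ x)) : H) -
      unitaryExp (𝒳.A t) τ (Y (𝒳.toN x)) -
      (𝒳.germExp t τ (𝒳.P x) + Y (𝒳.toN (𝒳.germExp t τ x)) -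
        (unitaryExp (𝒳.A t) τ (𝒳.P x) + unitaryExp (𝒳.A t) τ (Y (𝒳.toN x)))) := by
    rw [hJ]
    abel
  have hY1 := hYn _ (norm_germExp_apply (𝒳 := 𝒳) (t := t) τ x)
  have hY2 := hYn x rfl
  rw [← hU.norm_apply τ] at hY2
  rw [hsum]
  refine (norm_sub_le _ _).trans ((add_le_add (norm_sub_le _ _) hmain).trans ?_)
  linarith

/-! ### Constants and smallness conditions -/

theorem C_T_bounds {δ : ℝ} (hδ : 0 < δ) (hδ1 : δ ≤ 1) :
    1 ≤ 𝒳.C_T δ ∧ ‖𝒳.Xp‖ / Real.sqrt δ ≤ 𝒳.C_T δ ∧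
      31 * (𝒳.schurConst (Real.sqrt δ) * ‖𝒳.Xp‖) ^ 2 + ‖𝒳.Xp‖ / Real.sqrt δ / 2 * ‖𝒳.Xp‖ ^ 2 ≤
        125 * 𝒳.C_T δ ^ (2 * p + 2) := by
  have hs : 0 < Real.sqrt δ := Real.sqrt_pos.2 hδ
  have hs1 : Real.sqrt δ ≤ 1 := Real.sqrt_le_one.2 hδ1
  have hC := 𝒳.one_le_C₀
  have hp : (2 : ℝ) ≤ p := by exact_mod_cast 𝒳.two_le
  have hb0 : 0 ≤ ‖𝒳.Xp‖ / Real.sqrt δ := by positivity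
  have hX : ‖𝒳.Xp‖ ≤ ‖𝒳.Xp‖ / Real.sqrt δ := le_div_self (norm_nonneg _) hs hs1
  have hX0 := norm_nonneg 𝒳.Xp
  -- With `b = ‖X_p‖ / √δ` every factor is controlled by `D = p C₀² + b² ≥ 1`: `b ≤ D`, `‖X_p‖² ≤ D`
  -- and `p C₀ + b ≤ 2D`. Hence `31 · 4 D³ + D²/2 ≤ 125 D³`, and `3 ≤ 2p + 2`.
  have hD : 𝒳.C_T δ = p * 𝒳.C₀ ^ 2 + (‖𝒳.Xp‖ / Real.sqrt δ) ^ 2 := by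
    rw [C_T, div_pow, Real.sq_sqrt hδ.le, div_eq_mul_inv]
  rw [schurConst]
  generalize ‖𝒳.Xp‖ / Real.sqrt δ = b at *
  generalize 𝒳.C_T δ = D at *
  generalize ‖𝒳.Xp‖ = x at *
  generalize 𝒳.C₀ = c at *
  have hpc : p * c ≤ p * c ^ 2 := by
    nlinarith [mul_nonneg (mul_nonneg (zero_le_two.trans hp) (zero_le_one.trans hC)) (sub_nonneg.2 hC)]
  have hpc2 : 2 ≤ p * c := by nlinarith
  have hD1 : 1 ≤ D := by nlinarith [sq_nonneg b]
  have hbD : b ≤ D := by nlinarith [sq_nonneg (b - 1)]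
  have hxD : x ^ 2 ≤ D := by nlinarith
  have hk : (p * c + b) ≤ 2 * D := by nlinarith [sq_nonneg b]
  refine ⟨hD1, hbD, ?_⟩
  have hp2 := 𝒳.two_le
  have h3 : D ^ 3 ≤ D ^ (2 * p + 2) := pow_le_pow_right₀ hD1 (by omega)
  have hk2 : (p * c + b) ^ 2 ≤ (2 * D) ^ 2 := pow_le_pow_left₀ (by positivity) hk 2
  calc 31 * ((p * c + b) * x) ^ 2 + b / 2 * x ^ 2
      = 31 * ((p * c + b) ^ 2 * x ^ 2) + b / 2 * x ^ 2 := by ring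
    _ ≤ 31 * ((2 * D) ^ 2 * D) + D / 2 * D := by gcongr
    _ ≤ 125 * D ^ 3 := by nlinarith [mul_nonneg (sq_nonneg D) (sub_nonneg.2 hD1)]
    _ ≤ _ := by gcongr

theorem small_sqrt {δ t₀ : ℝ} (hδ : 0 < δ) (hδd : ENNReal.ofReal δ ≤ 𝒳.d₀ / 36) (hδ4 : δ ≤ 1 / 4)
    (ht₀ : t₀ ≤ Real.sqrt δ * (𝒳.C₁)⁻¹) (ht : |t| ≤ t₀) : 𝒳.Small (Real.sqrt δ) t := by
  have hs : 0 < Real.sqrt δ := Real.sqrt_pos.2 hδ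
  have hs2 : Real.sqrt δ ≤ 1 / 2 := by
    rw [Real.sqrt_le_left (by norm_num)]
    linarith
  have hC := 𝒳.one_le_C₀
  have hp : (2 : ℝ) ≤ p := by exact_mod_cast 𝒳.two_le
  have h1 : ((p : ℝ) - 1) * 𝒳.C₀ ≤ 𝒳.C₁ := le_max_left _ _
  have h2 : ‖𝒳.Xp‖ ≤ 𝒳.C₁ := le_max_right _ _
  -- From `p ≥ 2` and `C₀ ≥ 1`; hence `|t| ≤ √δ ≤ 1/2`.
  have h3 : 1 ≤ 𝒳.C₁ := by nlinarith
  have h4 : |t| * 𝒳.C₁ ≤ Real.sqrt δ := by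
    have := ht.trans ht₀
    rwa [← div_eq_mul_inv, le_div_iff₀ (by linarith)] at this
  refine ⟨hs, by linarith, ?_, ?_, ?_, fun u hu => ?_⟩
  · nlinarith [abs_nonneg t]
  · nlinarith [abs_nonneg t, mul_le_mul_of_nonneg_left h1 (abs_nonneg t)]
  · exact (mul_le_mul_of_nonneg_left h2 (abs_nonneg t)).trans h4
  -- The choice `m = 36δ = (6√δ)²` is the source of the `6s` in `Small.gap`.
  · have hgap := mul_norm_sq_le_of_opSpectrum 𝒳.dense_domain 𝒳.isClosed (m := 36 * δ)
      (by positivity) (fun z hz hz0 => ?_) u hu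
    · refine abs_le_of_sq_le_sq' ?_ (norm_nonneg _) |>.2
      rw [mul_pow, mul_pow, Real.sq_sqrt hδ.le]
      linarith
    · have h5 : 𝒳.d₀ ≤ ENNReal.ofReal ‖z‖ := by
        refine (Metric.infEDist_le_edist_of_mem
        (show z ∈ opSpectrum 𝒳.A₀ \ {0} from ⟨hz, hz0⟩)).trans_eq ?_
        rw [edist_comm, edist_dist, dist_zero_right]
      have h6 : ENNReal.ofReal δ * 36 ≤ ENNReal.ofReal ‖z‖ := by
        rw [ENNReal.le_div_iff_mul_le (by simp) (by simp)] at hδd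
        exact hδd.trans h5
      have h7 : (36 : ENNReal) = ENNReal.ofReal 36 := by simp
      rw [h7, ← ENNReal.ofReal_mul hδ.le, ENNReal.ofReal_le_ofReal_iff (norm_nonneg _)] at h6
      linarith

end OperatorPencil

/-! ### The smoothing factor and the conclusion -/

theorem smoothing_bound {p : ℕ} (hp : 2 ≤ p) {a b t t₀ ε τ N : ℝ} (ha : 0 ≤ a) (hb : 0 ≤ b)
    (hε : 0 < ε) (ht : |t| ≤ t₀)
    (hN : N ≤ |t| ^ p * a + |t| ^ (2 * p + 2) * b * |τ * (ε ^ (2 * p))⁻¹|) :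
    N * (ε ^ (2 * p + 2) / (t ^ 2 + ε ^ 2) ^ (p + 1)) ≤ (a * t₀ ^ (p - 2) + b * |τ|) * ε ^ 2 := by
  have hq : 0 < t ^ 2 + ε ^ 2 := by positivity
  have ht₀ : 0 ≤ t₀ := (abs_nonneg t).trans ht
  rw [abs_mul, abs_inv, abs_of_pos (pow_pos hε (2 * p))] at hN
  -- Only `t²` out of `|t|^p` is matched against the denominator, through `t² ε^{2p} ≤ (t² +
  -- ε²)^{p+1}`; the rest is bounded by `t₀^{p-2}`. In the second term `ε^{-2p}` cancels all of
  -- `ε^{2p+2}` but `ε²`.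
  have hp' : |t| ^ p = |t| ^ (p - 2) * t ^ 2 := by
    rw [← sq_abs t, ← pow_add, Nat.sub_add_cancel hp]
  have h1 : t ^ 2 * ε ^ (2 * p) ≤ (t ^ 2 + ε ^ 2) ^ (p + 1) := by
    rw [pow_succ' (t ^ 2 + ε ^ 2) p, pow_mul ε 2 p]
    gcongr
    · nlinarith
    · nlinarith
  have h2 : |t| ^ (2 * p + 2) ≤ (t ^ 2 + ε ^ 2) ^ (p + 1) := by
    rw [show 2 * p + 2 = 2 * (p + 1) by ring, pow_mul, sq_abs]
    gcongr
    nlinarith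
  rw [← mul_div_assoc, div_le_iff₀ (by positivity)]
  calc N * ε ^ (2 * p + 2)
      ≤ (|t| ^ p * a + |t| ^ (2 * p + 2) * b * (|τ| * (ε ^ (2 * p))⁻¹)) * ε ^ (2 * p + 2) := by
        gcongr
    _ = (a * |t| ^ (p - 2) * (t ^ 2 * ε ^ (2 * p)) + b * |τ| * |t| ^ (2 * p + 2)) * ε ^ 2 := by
        rw [hp', pow_add ε]
        field_simp
    _ ≤ (a * t₀ ^ (p - 2) * (t ^ 2 + ε ^ 2) ^ (p + 1) +
          b * |τ| * (t ^ 2 + ε ^ 2) ^ (p + 1)) * ε ^ 2 := by gcongr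
    _ = _ := by ring

theorem mainTheorem10 (p : ℕ) (hp : 2 ≤ p) :
    ∃ c₄ c₅ : ℝ, 0 < c₄ ∧ 0 < c₅ ∧
      ∀ (H : Type u) (K : Type v)
        [NormedAddCommGroup H] [InnerProductSpace ℂ H] [CompleteSpace H]
        [TopologicalSpace.SeparableSpace H]
        [NormedAddCommGroup K] [InnerProductSpace ℂ K] [CompleteSpace K]
        [TopologicalSpace.SeparableSpace K]
        (𝒳 : OperatorPencil p H K) (δ t₀ : ℝ),
        0 < δ → ENNReal.ofReal δ ≤ 𝒳.d₀ / 36 → δ ≤ 1 / 4 →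
        0 < t₀ → t₀ ≤ Real.sqrt δ * (𝒳.C₁)⁻¹ →
        𝒳.G = 0 →
        ∀ τ ε t : ℝ, 0 < ε → |t| ≤ t₀ →
          ‖𝒳.J t (τ * (ε ^ (2 * p))⁻¹)‖ * (ε ^ (2 * p + 2) / (t ^ 2 + ε ^ 2) ^ (p + 1)) ≤
            (2 * (c₄ * 𝒳.C_T δ ^ p) * t₀ ^ (p - 2) +
              (c₅ * 𝒳.C_T δ ^ (2 * p + 2)) * |τ|) * ε ^ 2 := by
  refine ⟨1, 125, one_pos, by norm_num, ?_⟩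
  intro H K _ _ _ _ _ _ _ _ 𝒳 δ t₀ hδ hδd hδ4 _ ht₀ hG τ ε t hε ht
  have hsmall := OperatorPencil.small_sqrt hδ hδd hδ4 ht₀ ht
  obtain ⟨hD, hb, hE⟩ := OperatorPencil.C_T_bounds (𝒳 := 𝒳) hδ (by linarith)
  -- The coefficient of `|t|^p` is at most `C_T`, and `C_T ≥ 1` allows the power `p`.
  have hDp : 𝒳.C_T δ ≤ 𝒳.C_T δ ^ p := le_self_pow₀ hD (by omega)
  refine smoothing_bound hp (by positivity) (by positivity) hε ht
    ((hsmall.norm_J_le hG _).trans ?_)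
  gcongr
  linarith
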